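/- Let \[ \mathbb E=\{(a_{11},a_{22},\det A): A=[a_{ij}]\in \mathcal M_2(\mathbb C),\ \|A\|<1\}\subset\mathbb C^3 \] be the tetrablock ($\|\cdot\|$ is the operator norm), and let $W=\{(x_1,x_2,x_3)\in\mathbb E : x_1x_2=x_3\}$ be its triangular variety. A commuting triple $(A,B,C)$ of bounded operators on a complex Hilbert space is an $\mathbb E$-contraction if $\overline{\mathbb E}$ is a spectral set for it, that is, the Taylor joint spectrum $\sigma_T(A,B,C)$ is contained in $\overline{\mathbb E}$ and $\|f(A,B,C)\|\le\sup_{\overline{\mathbb E}}|f|$ for every rational function $f=p/q$, $p,q\in\mathbb C[z_1,z_2,z_3]$, such that $q$ has no zero in $\overline{\mathbb E}$, where $f(A,B,C)=p(A,B,C)\,q(A,B,C)^{-1}$. It is a triangular $\mathbb E$-contraction if moreover $(A,B,C)=(P,Q,PQ)$ for a pair of commuting contractions $P,Q$. \textbf{Proposition.} The closure $\overline W$ is a complete spectral set for every triangular $\mathbb E$-contraction $(P,Q,PQ)$. That is, $\sigma_T(P,Q,PQ)\subseteq\overline W$, and for every $k$ and every $k\times k$ matrix $f=[p_{ij}/q_{ij}]$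 of rational functions, with $p_{ij},q_{ij}\in\mathbb C[z_1,z_2,z_3]$ such that no $q_{ij}$ has a zero in $\overline W$, every operator $q_{ij}(P,Q,PQ)$ is invertible and \[ \big\|\,[\,p_{ij}(P,Q,PQ)\,q_{ij}(P,Q,PQ)^{-1}]_{i,j}\big\|\le\sup_{z\in\overline W}\big\|\,[\,p_{ij}(z)/q_{ij}(z)]_{i,j}\big\|, \] where the left-hand norm is the operator norm on the direct sum of $k$ copies of the Hilbert space and the right-hand norm is the operator norm on $\mathbb C^k$. -/

import Mathlib

noncomputable section

namespace Tetrablock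

/-- The tetrablock: all `(a₁₁, a₂₂, det A)` with `A` a complex `2 × 2` matrix of Euclidean operator
norm less than `1`. -/
def tetrablock : Set (Fin 3 → ℂ) :=
  {x | ∃ A : Matrix (Fin 2) (Fin 2) ℂ,
    ‖Matrix.toEuclideanCLM (n := Fin 2) (𝕜 := ℂ) A‖ < 1 ∧ x = ![A 0 0, A 1 1, A.det]}

/-- The triangular variety of the tetrablock: its points with `x₁ x₂ = x₃`. -/
def triangularVariety : Set (Fin 3 → ℂ) :=
  {x | x ∈ tetrablock ∧ x 0 * x 1 = x 2}

section Operators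

variable {H : Type*} [NormedAddCommGroup H] [InnerProductSpace ℂ H] {n : ℕ}

/-- The Koszul differential of a tuple of operators on the exterior algebra `Λ(ℂⁿ) ⊗ H`. An element
`∑ f(S) ⊗ e_S`, where `e_S` is the wedge product of the `e_i`, `i ∈ S`, in increasing order, is
given by its coefficients `f(S)`, and the differential is `∑ T_i ⊗ (e_i ∧ ·)`. -/
def koszul (T : Fin n → H →L[ℂ] H) (f : Finset (Fin n) → H) : Finset (Fin n) → H :=
  fun S => ∑ i ∈ S, (-1 : ℂ) ^ (S.filter (fun j => j < i)).card • T i (f (S.erase i))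

/-- The Taylor joint spectrum of a commuting tuple: all `z` such that the Koszul complex of
`(T₁ - z₁, …, Tₙ - zₙ)` is not exact. (The differential raises degrees by one, so exactness on the
whole exterior algebra is exactness in every degree.) -/
def taylorSpectrum (T : Fin n → H →L[ℂ] H) : Set (Fin n → ℂ) :=
  {z | ¬ Function.Exact (koszul fun i => T i - z i • (1 : H →L[ℂ] H))
    (koszul fun i => T i - z i • (1 : H →L[ℂ] H))}

/-- The value `p(T₁, …, Tₙ)` of a polynomial at a (commuting) tuple of operators. -/
def polyEval (T : Fin n → H →L[ℂ] H) (p : MvPolynomial (Fin n) ℂ) : H →L[ℂ] H :=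
  ∑ m ∈ p.support, p.coeff m • (List.ofFn fun i => T i ^ m i).prod

/-- The value `p(T) q(T)⁻¹` of the rational function `p / q`; meaningful when `q(T)` is
invertible. -/
def ratEval (T : Fin n → H →L[ℂ] H) (p q : MvPolynomial (Fin n) ℂ) : H →L[ℂ] H :=
  polyEval T p * Ring.inverse (polyEval T q)

/-- The operator on the Hilbert space direct sum `H ⊕ ⋯ ⊕ H` given by a matrix of operators:
`(F x)_i = ∑ j, F i j (x_j)`. -/
def blockOperator {k : ℕ} (F : Matrix (Fin k) (Fin k) (H →L[ℂ] H)) :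
    PiLp 2 (fun _ : Fin k => H) →L[ℂ] PiLp 2 (fun _ : Fin k => H) :=
  (PiLp.continuousLinearEquiv 2 ℂ (fun _ : Fin k => H)).symm.toContinuousLinearMap.comp
    (ContinuousLinearMap.pi fun i => ∑ j, (F i j).comp (PiLp.proj 2 (fun _ : Fin k => H) j))

/-- `X` is a spectral set for the commuting tuple `T`: `X` contains the Taylor joint spectrum and
`‖f(T)‖ ≤ sup_X |f|` for all rational functions `f = p / q` such that `q` has no zero in `X`. -/
def IsSpectralSet (X : Set (Fin n → ℂ)) (T : Fin n → H →L[ℂ] H) : Prop :=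
  taylorSpectrum T ⊆ X ∧
    ∀ p q : MvPolynomial (Fin n) ℂ, (∀ z ∈ X, q.eval z ≠ 0) →
      IsUnit (polyEval T q) ∧
      ‖ratEval T p q‖ₑ ≤ ⨆ z ∈ X, ‖p.eval z / q.eval z‖ₑ

/-- `X` is a complete spectral set for the commuting tuple `T`: `X` contains the Taylor joint
spectrum and `‖f(T)‖ ≤ sup_X ‖f‖` for all square matrices `f = [p_{ij} / q_{ij}]`, of any size, of
rational functions whose denominators have no zero in `X`. Here `f(T)` is the operator matrix
`[p_{ij}(T) q_{ij}(T)⁻¹]`, and both norms are operator norms. -/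
def IsCompleteSpectralSet (X : Set (Fin n → ℂ)) (T : Fin n → H →L[ℂ] H) : Prop :=
  taylorSpectrum T ⊆ X ∧
    ∀ (k : ℕ) (p q : Matrix (Fin k) (Fin k) (MvPolynomial (Fin n) ℂ)),
      (∀ i j, ∀ z ∈ X, (q i j).eval z ≠ 0) →
      (∀ i j, IsUnit (polyEval T (q i j))) ∧
      ‖blockOperator (Matrix.of fun i j => ratEval T (p i j) (q i j))‖ₑ ≤
        ⨆ z ∈ X, ‖Matrix.toEuclideanCLM (n := Fin k) (𝕜 := ℂ)
          (Matrix.of fun i j => (p i j).eval z / (q i j).eval z)‖ₑ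

/-- An `𝔼`-contraction: a commuting triple of operators for which the closed tetrablock is a
spectral set. -/
def IsEContraction (T : Fin 3 → H →L[ℂ] H) : Prop :=
  (∀ i j, Commute (T i) (T j)) ∧ IsSpectralSet (closure tetrablock) T

/-- A triangular `𝔼`-contraction: an `𝔼`-contraction of the form `(P, Q, PQ)` for a pair of
commuting contractions `P`, `Q`. -/
def IsTriangularEContraction (T : Fin 3 → H →L[ℂ] H) : Prop :=
  IsEContraction T ∧
    ∃ P Q : H →L[ℂ] H, ‖P‖ ≤ 1 ∧ ‖Q‖ ≤ 1 ∧ Commute P Q ∧ T = ![P, Q, P * Q]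

end Operators

end Tetrablock

end

/-! The closure of the triangular variety contains `bidiscGraph`, the graph of `(z₁, z₂) ↦ z₁ z₂`
over the closed bidisc, so both halves of the claim reduce to statements about two commuting
contractions on that graph.

Spectrum: at a point off the graph, one of `P - z₁`, `Q - z₂` is invertible or a combination of `P -
z₁`, `Q - z₂`, `PQ - z₃` is a nonzero scalar. Either way some `C_i` satisfy `∑ C_i (T_i - z_i) = 1`,
and these give a contracting homotopy of the Koszul complex.

Norm bound: this is Andô's theorem for matrices of rational functions. Commuting unitaries generate
a commutative C⋆-algebra, where Gelfand theory gives the bound (`norm_matrixOperator_map_le`). It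
passes to compressions of unitaries (`norm_matrixOperator_ratEval_le_of_compression`) because
denominators are inverted inside a closed commutative algebra of pairs (operator, compression).

The dilation is explicit when `T = AB` has norm less than one. With `d_A* d_A = 1 - A*A` and `d_B`
likewise, both `e h = (d_A h, d_B A h)` and `e' h = (d_A B h, d_B h)` have squared norm `‖h‖² - ‖T
h‖²`. Hence `h ↦ (e Tⁿ h)ₙ` embeds `H` in sequences so that `T` becomes a compression of the
backward shift `S`, and a unitary `W` extends `e h ↦ e' h`. With `p` the projection on the first
coordinate, `W*(pS + 1 - p)` and `pW + (1 - p)WS` are commuting unitaries with product `S` that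
compress to `A` and `B`. The general case follows by applying this to `rP`, `rQ` and letting `r →
1`. -/

noncomputable section

namespace Tetrablock

/-! ### Exactness of the Koszul complex from a contracting homotopy. -/

section Koszul

variable {H : Type*} [NormedAddCommGroup H] [InnerProductSpace ℂ H] {n : ℕ}

/-- The sign of moving `e_i` into its place in the wedge product `e_S`. -/
def koszulSign (S : Finset (Fin n)) (i : Fin n) : ℂ :=
  (-1 : ℂ) ^ (S.filter (fun j => j < i)).card

lemma koszulSign_mul_self (S : Finset (Fin n)) (i : Fin n) :
    koszulSign S i * koszulSign S i = 1 := by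
  rw [koszulSign, ← pow_add, ← two_mul, pow_mul]; simp

lemma koszulSign_insert {S : Finset (Fin n)} {j : Fin n} (hj : j ∉ S) (i : Fin n) :
    koszulSign (insert j S) i = koszulSign S i * if j < i then -1 else 1 := by
  unfold koszulSign
  rw [Finset.filter_insert]
  split_ifs with h
  · rw [Finset.card_insert_of_notMem (by simp [hj]), pow_succ]
  · simp

lemma koszulSign_erase {S : Finset (Fin n)} {i : Fin n} (hi : i ∈ S) (j : Fin n) :
    koszulSign (S.erase i) j = koszulSign S j * if i < j then -1 else 1 := by
  have h := koszulSign_insert (Finset.notMem_erase i S) j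
  rw [Finset.insert_erase hi] at h
  rw [h, mul_assoc]
  split_ifs <;> simp

lemma koszul_apply (T : Fin n → H →L[ℂ] H) (f : Finset (Fin n) → H) (S : Finset (Fin n)) :
    koszul T f S = ∑ i, if i ∈ S then koszulSign S i • T i (f (S.erase i)) else 0 := by
  simp [koszul, koszulSign]

/-- Removing `i` and then `j` gives the opposite sign to removing `j` and then `i`, so the double
sum is antisymmetric and equals its own negative. -/
lemma koszul_koszul {T : Fin n → H →L[ℂ] H} (hT : ∀ i j, Commute (T i) (T j))
    (f : Finset (Fin n) → H) : koszul T (koszul T f) = 0 := by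
  funext S
  set F : Fin n → Fin n → H := fun i j => if i ∈ S then if j ∈ S.erase i then
    (koszulSign S i * koszulSign (S.erase i) j) • T i (T j (f ((S.erase i).erase j))) else 0 else 0
    with hF
  have hsum : koszul T (koszul T f) S = ∑ i, ∑ j, F i j := by
    rw [koszul_apply]
    refine Finset.sum_congr rfl fun i _ => ?_
    split_ifs with hi
    · rw [koszul_apply, map_sum, Finset.smul_sum]
      refine Finset.sum_congr rfl fun j _ => ?_
      simp only [hF, if_pos hi]
      split_ifs
      · rw [map_smul, smul_smul]
      · simp
    · simp [hF, hi]
  have hanti : ∀ i j, F i j = -F j i := by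
    intro i j
    simp only [hF]
    by_cases hij : i = j
    · subst hij; simp
    by_cases hi : i ∈ S <;> by_cases hj : j ∈ S
    · have hc : T i (T j (f ((S.erase i).erase j))) = T j (T i (f ((S.erase j).erase i))) := by
        rw [Finset.erase_right_comm]
        exact congrArg (fun X : H →L[ℂ] H => X (f ((S.erase j).erase i))) (hT i j)
      rw [if_pos hi, if_pos hj, if_pos (Finset.mem_erase.2 ⟨Ne.symm hij, hj⟩),
        if_pos (Finset.mem_erase.2 ⟨hij, hi⟩), hc, koszulSign_erase hi, koszulSign_erase hj,
        ← neg_smul]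
      congr 1
      rcases lt_or_gt_of_ne hij with h | h
      · rw [if_pos h, if_neg h.not_gt]; ring
      · rw [if_pos h, if_neg h.not_gt]; ring
    all_goals simp [hi, hj]
  have h2 : ∑ i, ∑ j, F i j = -∑ i, ∑ j, F i j := by
    conv_lhs => rw [Finset.sum_comm]
    rw [← Finset.sum_neg_distrib]
    refine Finset.sum_congr rfl fun i _ => ?_
    rw [← Finset.sum_neg_distrib]
    exact Finset.sum_congr rfl fun j _ => hanti j i
  rw [hsum, Pi.zero_apply]
  have h3 := eq_neg_iff_add_eq_zero.1 h2
  rw [← two_smul ℂ] at h3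
  exact (smul_eq_zero.1 h3).resolve_left two_ne_zero

/-- The contracting homotopy of the Koszul complex given by operators `C_i` with
`∑ C_i T_i = 1`. -/
def koszulHomotopy (C : Fin n → H →L[ℂ] H) (f : Finset (Fin n) → H) : Finset (Fin n) → H :=
  fun S => ∑ i, if i ∉ S then koszulSign S i • C i (f (insert i S)) else 0

/-- The off-diagonal terms of the two composites cancel by sign. For each `i` exactly one composite
has a diagonal term, namely `C_i T_i f(S)`, and these add up to `f(S)`. -/
lemma koszul_homotopy {T C : Fin n → H →L[ℂ] H} (hC : ∀ i j, Commute (C i) (T j))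
    (h1 : ∑ i, C i * T i = 1) (f : Finset (Fin n) → H) :
    koszul T (koszulHomotopy C f) + koszulHomotopy C (koszul T f) = f := by
  funext S
  set A : Fin n → Fin n → H := fun i j => if i ∈ S then if j ∉ S.erase i then
    (koszulSign S i * koszulSign (S.erase i) j) • T i (C j (f (insert j (S.erase i)))) else 0 else 0
    with hA
  set B : Fin n → Fin n → H := fun i j => if j ∉ S then if i ∈ insert j S then
    (koszulSign S j * koszulSign (insert j S) i) • C j (T i (f ((insert j S).erase i))) else 0 else 0
    with hB
  have hsumA : koszul T (koszulHomotopy C f) S = ∑ i, ∑ j, A i j := by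
    rw [koszul_apply]
    refine Finset.sum_congr rfl fun i _ => ?_
    by_cases hi : i ∈ S
    · rw [if_pos hi, koszulHomotopy, map_sum, Finset.smul_sum]
      refine Finset.sum_congr rfl fun j _ => ?_
      simp only [hA, if_pos hi]
      by_cases hj : j ∉ S.erase i
      · rw [if_pos hj, if_pos hj, map_smul, smul_smul]
      · rw [if_neg hj, if_neg hj]; simp
    · simp [hA, hi]
  have hsumB : koszulHomotopy C (koszul T f) S = ∑ i, ∑ j, B i j := by
    rw [Finset.sum_comm, koszulHomotopy]
    refine Finset.sum_congr rfl fun j _ => ?_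
    by_cases hj : j ∉ S
    · rw [if_pos hj, koszul_apply, map_sum, Finset.smul_sum]
      refine Finset.sum_congr rfl fun i _ => ?_
      simp only [hB, if_pos hj]
      by_cases hi : i ∈ insert j S
      · rw [if_pos hi, if_pos hi, map_smul, smul_smul]
      · rw [if_neg hi, if_neg hi]; simp
    · simp only [hB, if_neg hj]; simp
  have hcomm : ∀ i j x, C i (T j x) = T j (C i x) := fun i j x =>
    congrArg (fun X : H →L[ℂ] H => X x) (hC i j)
  have hAB : ∀ i j, A i j + B i j = if i = j then C i (T i (f S)) else 0 := by
    intro i j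
    by_cases hij : i = j
    · subst hij
      by_cases hi : i ∈ S
      · simp [hA, hB, hi, koszulSign_erase, koszulSign_mul_self, hcomm]
      · simp [hA, hB, hi, koszulSign_insert, koszulSign_mul_self]
    · rw [if_neg hij]
      by_cases hi : i ∈ S
      · by_cases hj : j ∈ S
        · simp [hA, hB, hj, Ne.symm hij]
        · simp only [hA, hB, if_pos hi, if_pos hj]
          have hji : j ∉ S.erase i := by simp [hj]
          rw [if_pos hji, if_pos (Finset.mem_insert_of_mem hi), hcomm,
            Finset.erase_insert_of_ne (Ne.symm hij), ← add_smul, koszulSign_erase hi,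
            koszulSign_insert hj]
          convert zero_smul ℂ _
          rcases lt_or_gt_of_ne hij with h | h
          · rw [if_pos h, if_neg h.not_gt]; ring
          · rw [if_pos h, if_neg h.not_gt]; ring
      · simp [hA, hB, hi, hij]
  rw [Pi.add_apply, hsumA, hsumB, ← Finset.sum_add_distrib]
  simp_rw [← Finset.sum_add_distrib, hAB]
  have := congrArg (fun X : H →L[ℂ] H => X (f S)) h1
  simpa using this

lemma exact_koszul {T C : Fin n → H →L[ℂ] H} (hT : ∀ i j, Commute (T i) (T j))
    (hC : ∀ i j, Commute (C i) (T j)) (h1 : ∑ i, C i * T i = 1) :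
    Function.Exact (koszul T) (koszul T) := by
  intro f
  constructor
  · intro hf
    refine ⟨koszulHomotopy C f, ?_⟩
    have h := koszul_homotopy hC h1 f
    rw [hf] at h
    have h0 : koszulHomotopy C (0 : Finset (Fin n) → H) = 0 := by
      funext S; simp [koszulHomotopy]
    rwa [h0, add_zero] at h
  · rintro ⟨g, rfl⟩
    exact koszul_koszul hT g

end Koszul

/-! ### The closed bidisc inside the closure of the triangular variety. -/

section Variety

/-- The points of the closed bidisc, embedded as `(z₁, z₂, z₁ z₂)`. -/
def bidiscGraph : Set (Fin 3 → ℂ) :=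
  {z | ‖z 0‖ ≤ 1 ∧ ‖z 1‖ ≤ 1 ∧ z 2 = z 0 * z 1}

lemma mem_triangularVariety {a b : ℂ} (ha : ‖a‖ < 1) (hb : ‖b‖ < 1) :
    ![a, b, a * b] ∈ triangularVariety := by
  refine ⟨⟨Matrix.diagonal ![a, b], ?_, ?_⟩, by simp⟩
  · have := Matrix.l2_opNorm_diagonal (𝕜 := ℂ) ![a, b]
    rw [Matrix.cstar_norm_def] at this
    rw [this, pi_norm_lt_iff one_pos]
    intro i
    fin_cases i <;> simpa
  · ext i
    fin_cases i <;> simp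

/-- Shrinking the first two coordinates by `r < 1` gives a point realized by a strictly contractive
diagonal matrix; then `r → 1`. -/
lemma bidiscGraph_subset_closure : bidiscGraph ⊆ closure triangularVariety := by
  rintro z ⟨h0, h1, h2⟩
  have hc : Continuous fun r : ℝ => (![(r : ℂ) * z 0, r * z 1, (r * z 0) * (r * z 1)] : Fin 3 → ℂ) := by
    fun_prop
  have hlim := (hc.tendsto 1).mono_left (nhdsWithin_le_nhds (s := Set.Iio 1))
  have hz : (![((1 : ℝ) : ℂ) * z 0, (1 : ℝ) * z 1, ((1 : ℝ) * z 0) * ((1 : ℝ) * z 1)] : Fin 3 → ℂ)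
      = z := by
    ext i
    fin_cases i <;> simp [h2]
  rw [hz] at hlim
  refine mem_closure_of_tendsto hlim ?_
  filter_upwards [Ioo_mem_nhdsLT (zero_lt_one (α := ℝ))] with r hr
  have hlt : ∀ w : ℂ, ‖w‖ ≤ 1 → ‖(r : ℂ) * w‖ < 1 := fun w hw => by
    rw [norm_mul, Complex.norm_real, Real.norm_of_nonneg hr.1.le]
    nlinarith [hr.1, hr.2, norm_nonneg w]
  exact mem_triangularVariety (hlt _ h0) (hlt _ h1)

end Variety

/-! ### The Taylor spectrum of `(P, Q, PQ)`. -/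

section Spectrum

variable {H : Type*} [NormedAddCommGroup H] [InnerProductSpace ℂ H] [CompleteSpace H]

lemma isUnit_sub_smul_one {P : H →L[ℂ] H} (hP : ‖P‖ ≤ 1) {c : ℂ} (hc : 1 < ‖c‖) :
    IsUnit (P - c • (1 : H →L[ℂ] H)) := by
  have h : c ∉ spectrum ℂ P := fun hmem => by
    have h1 := spectrum.norm_le_norm_mul_of_mem hmem
    have h2 : ‖(1 : H →L[ℂ] H)‖ ≤ 1 := ContinuousLinearMap.norm_id_le
    nlinarith [norm_nonneg P, norm_nonneg (1 : H →L[ℂ] H)]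
  rw [spectrum.notMem_iff, Algebra.algebraMap_eq_smul_one] at h
  simpa using h.neg

lemma taylorSpectrum_subset_bidiscGraph {P Q : H →L[ℂ] H} (hP : ‖P‖ ≤ 1) (hQ : ‖Q‖ ≤ 1)
    (hPQ : Commute P Q) : taylorSpectrum ![P, Q, P * Q] ⊆ bidiscGraph := by
  intro z hz
  by_contra hmem
  apply hz
  set T : Fin 3 → H →L[ℂ] H := ![P, Q, P * Q] with hTdef
  have hcT : ∀ i j, Commute (T i) (T j) := by
    intro i j
    fin_cases i <;> fin_cases j <;>
      simp [hTdef, hPQ, hPQ.symm, Commute.mul_left, Commute.mul_right]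
  have hsm : ∀ (X : H →L[ℂ] H) (c : ℂ), Commute X (c • (1 : H →L[ℂ] H)) := fun X c =>
    (Commute.one_right X).smul_right c
  have hcz : ∀ (X : H →L[ℂ] H), (∀ j, Commute X (T j)) →
      ∀ j, Commute X (T j - z j • (1 : H →L[ℂ] H)) := fun X hX j =>
    (hX j).sub_right (hsm X _)
  have hTz : ∀ i j, Commute (T i - z i • (1 : H →L[ℂ] H)) (T j - z j • (1 : H →L[ℂ] H)) :=
    fun i j => hcz _ (fun k => (hcT i k).sub_left (hsm _ _).symm) j
  have of_unit : ∀ i, IsUnit (T i - z i • (1 : H →L[ℂ] H)) →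
      Function.Exact (koszul fun i => T i - z i • (1 : H →L[ℂ] H))
        (koszul fun i => T i - z i • (1 : H →L[ℂ] H)) := by
    rintro i ⟨u, hu⟩
    refine exact_koszul (C := Pi.single i (↑u⁻¹ : H →L[ℂ] H)) hTz ?_ ?_
    · intro k j
      rcases eq_or_ne k i with rfl | hk
      · rw [Pi.single_eq_same]
        exact Commute.units_inv_left (hu ▸ hTz k j)
      · rw [Pi.single_eq_of_ne hk]
        exact Commute.zero_left _
    · rw [Finset.sum_eq_single i]
      · rw [Pi.single_eq_same, ← hu, Units.inv_mul]
      · intro k _ hk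
        rw [Pi.single_eq_of_ne hk, zero_mul]
      · simp
  by_cases h0 : 1 < ‖z 0‖
  · exact of_unit 0 (isUnit_sub_smul_one hP h0)
  by_cases h1 : 1 < ‖z 1‖
  · exact of_unit 1 (isUnit_sub_smul_one hQ h1)
  have h2 : z 0 * z 1 - z 2 ≠ 0 := fun h =>
    hmem ⟨not_lt.1 h0, not_lt.1 h1, (sub_eq_zero.1 h).symm⟩
  set c := (z 0 * z 1 - z 2)⁻¹ with hc
  -- The coefficients come from the identity `(PQ - z₂) - Q(P - z₀) - z₀(Q - z₁) = z₀z₁ - z₂`,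
  -- coordinates being indexed from zero.
  refine exact_koszul (C := ![-(c • Q), -((c * z 0) • 1), c • 1]) hTz ?_ ?_
  · intro i
    fin_cases i
    · exact hcz _ fun j => ((hcT 1 j).smul_left c).neg_left
    · exact hcz _ fun j => ((Commute.one_left _).smul_left _).neg_left
    · exact hcz _ fun j => (Commute.one_left _).smul_left _
  · have : (1 : H →L[ℂ] H) = (c * (z 0 * z 1 - z 2)) • 1 := by
      rw [hc, inv_mul_cancel₀ h2, one_smul]
    refine Eq.trans ?_ this.symm
    simp only [Fin.sum_univ_three, hTdef, Matrix.cons_val_zero, Matrix.cons_val_one,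
      Matrix.cons_val, mul_sub, neg_mul, smul_mul_assoc, one_mul,
      mul_smul_comm, mul_one, hPQ.eq]
    module

end Spectrum

/-! ### Gelfand theory for rational functions in a commutative Banach algebra. -/

section BanachAlgebra

/-- The triple `(t₁, t₂, t₁ t₂)`. -/
def graphTriple {R : Type*} [Mul R] (a b : R) : Fin 3 → R := ![a, b, a * b]

lemma map_graphTriple {R S F : Type*} [Mul R] [Mul S] [FunLike F R S] [MulHomClass F R S]
    (f : F) (a b : R) : (fun i => f (graphTriple a b i)) = graphTriple (f a) (f b) := by
  ext i
  fin_cases i <;> simp [graphTriple]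

variable {S : Type*} [NormedCommRing S] [NormedAlgebra ℂ S]

lemma algHom_graphTriple_mem [CompleteSpace S] (h1 : ‖(1 : S)‖ ≤ 1) {a b : S} (ha : ‖a‖ ≤ 1) (hb : ‖b‖ ≤ 1)
    (χ : S →ₐ[ℂ] ℂ) : graphTriple (χ a) (χ b) ∈ bidiscGraph := by
  have key : ∀ s : S, ‖s‖ ≤ 1 → ‖χ s‖ ≤ 1 := fun s hs =>
    (AlgHom.norm_apply_le_self_mul_norm_one χ s).trans (mul_le_one₀ hs (norm_nonneg _) h1)
  exact ⟨key a ha, key b hb, rfl⟩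

lemma algHom_aeval_graphTriple (a b : S) (χ : S →ₐ[ℂ] ℂ) (q : MvPolynomial (Fin 3) ℂ) :
    χ (MvPolynomial.aeval (graphTriple a b) q) = q.eval (graphTriple (χ a) (χ b)) := by
  rw [← map_graphTriple χ]
  have := MvPolynomial.comp_aeval_apply (φ := χ) (graphTriple a b) q
  rw [this]
  rfl

/-- A non-unit is annihilated by some character, and characters are contractive, so they send the
triple into `bidiscGraph`, where `q` has no zero. Asking for `‖1‖ ≤ 1` rather than `‖1‖ = 1` admits
the zero algebra, hence the zero Hilbert space. -/
lemma isUnit_aeval_graphTriple [CompleteSpace S] (h1 : ‖(1 : S)‖ ≤ 1) {a b : S} (ha : ‖a‖ ≤ 1) (hb : ‖b‖ ≤ 1)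
    {q : MvPolynomial (Fin 3) ℂ} (hq : ∀ z ∈ bidiscGraph, q.eval z ≠ 0) :
    IsUnit (MvPolynomial.aeval (graphTriple a b) q) := by
  by_contra h
  obtain ⟨f, hf⟩ := WeakDual.CharacterSpace.exists_apply_eq_zero h
  set χ : S →ₐ[ℂ] ℂ := WeakDual.CharacterSpace.toAlgHom f
  have h2 : χ (MvPolynomial.aeval (graphTriple a b) q) = 0 := hf
  rw [algHom_aeval_graphTriple] at h2
  exact hq _ (algHom_graphTriple_mem h1 ha hb χ) h2

/-- The value `p(t) q(t)⁻¹` at `t = (a, b, ab)` in a commutative algebra. -/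
def commRatEval (a b : S) (p q : MvPolynomial (Fin 3) ℂ) : S :=
  MvPolynomial.aeval (graphTriple a b) p * Ring.inverse (MvPolynomial.aeval (graphTriple a b) q)

lemma algHom_commRatEval {a b : S} {q : MvPolynomial (Fin 3) ℂ}
    (hq : IsUnit (MvPolynomial.aeval (graphTriple a b) q)) (p : MvPolynomial (Fin 3) ℂ)
    (χ : S →ₐ[ℂ] ℂ) : χ (commRatEval a b p q) =
      p.eval (graphTriple (χ a) (χ b)) / q.eval (graphTriple (χ a) (χ b)) := by
  have h : χ (MvPolynomial.aeval (graphTriple a b) q) ≠ 0 := (hq.map χ).ne_zero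
  rw [eq_div_iff (by rwa [← algHom_aeval_graphTriple]), ← algHom_aeval_graphTriple,
    ← algHom_aeval_graphTriple, commRatEval, ← map_mul, mul_assoc, Ring.inverse_mul_cancel _ hq,
    mul_one]

end BanachAlgebra

/-! ### Transport of the functional calculus along algebra homomorphisms. -/

section Evaluation

variable {H : Type*} [NormedAddCommGroup H] [InnerProductSpace ℂ H] {n : ℕ}

lemma polyEval_map {S : Type*} [CommRing S] [Algebra ℂ S] (π : S →ₐ[ℂ] (H →L[ℂ] H))
    (t : Fin n → S) (p : MvPolynomial (Fin n) ℂ) :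
    polyEval (fun i => π (t i)) p = π (MvPolynomial.aeval t p) := by
  rw [MvPolynomial.aeval_def, MvPolynomial.eval₂_eq', map_sum, polyEval]
  refine Finset.sum_congr rfl fun m _ => ?_
  rw [map_mul, AlgHom.commutes, Algebra.smul_def]
  congr 1
  rw [← List.prod_ofFn, map_list_prod, List.map_ofFn]
  congr 2
  ext1 i
  simp

lemma map_ring_inverse {R R' F : Type*} [Ring R] [Ring R'] [FunLike F R R'] [RingHomClass F R R']
    (f : F) {x : R} (hx : IsUnit x) : f (Ring.inverse x) = Ring.inverse (f x) := by
  obtain ⟨u, rfl⟩ := hx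
  rw [Ring.inverse_unit]
  exact (Ring.inverse_unit (Units.map (f : R →* R') u)).symm

lemma ratEval_map {S : Type*} [NormedCommRing S] [NormedAlgebra ℂ S] (π : S →ₐ[ℂ] (H →L[ℂ] H))
    (a b : S) {q : MvPolynomial (Fin 3) ℂ}
    (hq : IsUnit (MvPolynomial.aeval (graphTriple a b) q)) (p : MvPolynomial (Fin 3) ℂ) :
    ratEval (graphTriple (π a) (π b)) p q = π (commRatEval a b p q) := by
  rw [ratEval, ← map_graphTriple π, polyEval_map, polyEval_map, commRatEval, map_mul,
    map_ring_inverse π hq]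

end Evaluation

/-! ### Operator matrices. -/

section Block

variable {H : Type*} [NormedAddCommGroup H] [InnerProductSpace ℂ H] {ι : Type*} [Fintype ι]

/-- The operator on `⨁_ι H` with a given matrix of operators. -/
def matrixOperator (F : Matrix ι ι (H →L[ℂ] H)) :
    PiLp 2 (fun _ : ι => H) →L[ℂ] PiLp 2 (fun _ : ι => H) :=
  (PiLp.continuousLinearEquiv 2 ℂ (fun _ : ι => H)).symm.toContinuousLinearMap.comp
    (ContinuousLinearMap.pi fun i => ∑ j, (F i j).comp (PiLp.proj 2 (fun _ : ι => H) j))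

lemma matrixOperator_apply (F : Matrix ι ι (H →L[ℂ] H)) (x : PiLp 2 (fun _ : ι => H)) (i : ι) :
    matrixOperator F x i = ∑ j, F i j (x j) := by
  simp [matrixOperator]

lemma matrixOperator_mul (F G : Matrix ι ι (H →L[ℂ] H)) :
    matrixOperator (F * G) = matrixOperator F * matrixOperator G := by
  ext x i
  simp only [mul_apply_eq_comp, matrixOperator_apply, Matrix.mul_apply, map_sum,
    sum_apply]
  rw [Finset.sum_comm]

lemma matrixOperator_one [DecidableEq ι] :
    matrixOperator (1 : Matrix ι ι (H →L[ℂ] H)) = 1 := by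
  ext x i
  rw [matrixOperator_apply, Finset.sum_eq_single i]
  · simp
  · intro j _ hj; simp [Matrix.one_apply_ne hj.symm]
  · simp

lemma matrixOperator_pow [DecidableEq ι] (F : Matrix ι ι (H →L[ℂ] H)) (m : ℕ) :
    matrixOperator (F ^ m) = matrixOperator F ^ m := by
  induction m with
  | zero => simp [matrixOperator_one]
  | succ m ih => rw [pow_succ, pow_succ, matrixOperator_mul, ih]

lemma star_matrixOperator [CompleteSpace H] (F : Matrix ι ι (H →L[ℂ] H)) :
    star (matrixOperator F) = matrixOperator (star F) := by
  rw [ContinuousLinearMap.star_eq_adjoint]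
  symm
  rw [ContinuousLinearMap.eq_adjoint_iff]
  intro x y
  simp only [PiLp.inner_apply, matrixOperator_apply, sum_inner, inner_sum, Matrix.star_apply,
    ContinuousLinearMap.star_eq_adjoint, ContinuousLinearMap.adjoint_inner_left]
  rw [Finset.sum_comm]

/-- A crude constant suffices: it disappears when roots of high powers are taken. -/
lemma norm_matrixOperator_le {F : Matrix ι ι (H →L[ℂ] H)} {c : ℝ} (hc : 0 ≤ c)
    (hF : ∀ i j, ‖F i j‖ ≤ c) : ‖matrixOperator F‖ ≤ Fintype.card ι ^ 2 * c := by
  refine ContinuousLinearMap.opNorm_le_bound _ (by positivity) fun x => ?_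
  have h1 : ∀ y : PiLp 2 (fun _ : ι => H), ‖y‖ ≤ ∑ i, ‖y i‖ := fun y => by
    rw [PiLp.norm_eq_of_L2]
    refine Real.sqrt_le_iff.2 ⟨Finset.sum_nonneg fun i _ => norm_nonneg _, ?_⟩
    exact Finset.sum_sq_le_sq_sum_of_nonneg fun i _ => norm_nonneg _
  have h2 : ∀ i, ‖matrixOperator F x i‖ ≤ Fintype.card ι * (c * ‖x‖) := fun i => by
    rw [matrixOperator_apply]
    refine (norm_sum_le_of_le (n := fun _ => c * ‖x‖) _ fun j _ => ?_).trans (by simp)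
    refine ((F i j).le_opNorm _).trans ?_
    gcongr
    · exact hF i j
    · exact PiLp.norm_apply_le x j
  refine (h1 _).trans ((Finset.sum_le_sum fun i _ => h2 i).trans ?_)
  simp only [Finset.sum_const, Finset.card_univ, nsmul_eq_mul]
  apply le_of_eq
  ring

end Block

/-! ### Norms of matrices over a commutative C⋆-algebra. -/

section CStar

variable {K : Type*} [NormedAddCommGroup K] [InnerProductSpace ℂ K]
  {ι : Type*} [Fintype ι] [DecidableEq ι]

lemma norm_entry_le_norm_toEuclideanCLM (N : Matrix ι ι ℂ) (i j : ι) :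
    ‖N i j‖ ≤ ‖Matrix.toEuclideanCLM (n := ι) (𝕜 := ℂ) N‖ := by
  have h := (Matrix.toEuclideanCLM (n := ι) (𝕜 := ℂ) N).le_opNorm (EuclideanSpace.single j 1)
  refine le_trans (le_trans (le_of_eq ?_) (PiLp.norm_apply_le _ i)) (h.trans (by simp))
  simp [Matrix.ofLp_toEuclideanCLM]

lemma le_of_forall_pow_le_mul_pow {a b c : ℝ} (hb : 0 ≤ b)
    (h : ∀ m : ℕ, a ^ 2 ^ m ≤ c * b ^ 2 ^ m) : a ≤ b := by
  by_contra! hlt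
  have ha : 0 < a := hb.trans_lt hlt
  have h1 : ∀ m : ℕ, 1 ≤ c * (b / a) ^ 2 ^ m := fun m => by
    rw [div_pow, ← mul_div_assoc, le_div_iff₀ (by positivity), one_mul]
    exact h m
  have h2 : Filter.Tendsto (fun m : ℕ => c * (b / a) ^ 2 ^ m) Filter.atTop (nhds (c * 0)) :=
    ((tendsto_pow_atTop_nhds_zero_of_lt_one (by positivity) ((div_lt_one ha).2 hlt)).comp
      (tendsto_pow_atTop_atTop_of_one_lt one_lt_two)).const_mul c
  have h3 := ge_of_tendsto' h2 h1
  norm_num at h3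

/-- A power trick replaces any norm on matrices over `C`. The entries of `(F*F)^N` are bounded by
`M^(2N)` at every character, hence in norm, so `‖X‖^(2N) = ‖(X*X)^N‖` is at most a fixed constant
times `M^(2N)` for `N = 2^m`. -/
lemma norm_matrixOperator_map_le [CompleteSpace K] {C : Type*} [CommCStarAlgebra C]
    (ρ : C →⋆ₐ[ℂ] (K →L[ℂ] K)) (F : Matrix ι ι C) {M : ℝ} (hM : 0 ≤ M)
    (hF : ∀ χ : C →⋆ₐ[ℂ] ℂ, ‖Matrix.toEuclideanCLM (n := ι) (𝕜 := ℂ) (F.map χ)‖ ≤ M) :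
    ‖matrixOperator (F.map ρ)‖ ≤ M := by
  set X := matrixOperator (F.map ρ) with hX
  set G : Matrix ι ι C := star F * F with hG
  have hGX : ∀ N : ℕ, (star X * X) ^ N = matrixOperator ((G ^ N).map ρ) := fun N => by
    have h1 : (G ^ N).map ρ = (star (F.map ρ) * F.map ρ) ^ N := by
      have := map_pow (RingHom.mapMatrix (m := ι) (ρ : C →+* (K →L[ℂ] K))) G N
      rw [hG, map_mul] at this
      have hs : star (F.map ρ) = (star F).map ρ := by
        ext i j : 2
        simp [Matrix.star_apply, map_star]
      rw [hs]
      exact this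
    rw [h1, matrixOperator_pow, matrixOperator_mul, hX, star_matrixOperator]
  have hGχ : ∀ (N : ℕ) (i j : ι), ‖ρ ((G ^ N) i j)‖ ≤ (M ^ 2) ^ N := fun N i j => by
    refine (NonUnitalStarAlgHom.norm_apply_le ρ _).trans ?_
    have hiso := (gelfandTransform_isometry C).norm_map_of_map_zero (map_zero _) ((G ^ N) i j)
    rw [← hiso, ContinuousMap.norm_le _ (by positivity)]
    intro φ
    set χ : C →⋆ₐ[ℂ] ℂ :=
      { WeakDual.CharacterSpace.toAlgHom φ with map_star' := fun x => map_star φ x } with hχ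
    have h1 : (G ^ N).map χ = (star (F.map χ) * F.map χ) ^ N := by
      have := map_pow (RingHom.mapMatrix (m := ι) (χ : C →+* ℂ)) G N
      rw [hG, map_mul] at this
      have hs : star (F.map χ) = (star F).map χ := by
        ext i j : 2
        simp only [Matrix.star_apply, map_star, Matrix.map_apply]
      rw [hs]
      exact this
    have h2 : WeakDual.gelfandTransform ℂ C ((G ^ N) i j) φ = ((G ^ N).map χ) i j := rfl
    rw [h2, h1]
    refine (norm_entry_le_norm_toEuclideanCLM _ i j).trans ?_
    rw [map_pow, map_mul, map_star]
    have : Nonempty ι := ⟨i⟩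
    refine (norm_pow_le _ _).trans ?_
    refine pow_le_pow_left₀ (norm_nonneg _) ?_ N
    refine (CStarRing.norm_star_mul_self (x := Matrix.toEuclideanCLM (n := ι) (𝕜 := ℂ)
      (F.map χ))).trans_le ?_
    rw [← sq]
    exact pow_le_pow_left₀ (norm_nonneg _) (hF χ) 2
  have key : ∀ m : ℕ, (‖X‖ ^ 2) ^ 2 ^ m ≤ (Fintype.card ι : ℝ) ^ 2 * (M ^ 2) ^ 2 ^ m := fun m => by
    rw [sq ‖X‖, ← CStarRing.norm_star_mul_self, ← (IsSelfAdjoint.star_mul_self X).norm_pow_two_pow,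
      hGX]
    exact norm_matrixOperator_le (by positivity) fun i j => hGχ _ i j
  exact (sq_le_sq₀ (norm_nonneg _) hM).1 (le_of_forall_pow_le_mul_pow (by positivity) key)

end CStar

/-! ### The bound for two commuting unitaries. -/

section Unitary

universe u

variable {K : Type u} [NormedAddCommGroup K] [InnerProductSpace ℂ K] [CompleteSpace K]
  {ι : Type*} [Fintype ι] [DecidableEq ι]

lemma norm_unitary_le {U : K →L[ℂ] K} (hU : U ∈ unitary (K →L[ℂ] K)) : ‖U‖ ≤ 1 := by
  refine ContinuousLinearMap.opNorm_le_bound _ zero_le_one fun x => ?_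
  rw [one_mul, ContinuousLinearMap.norm_map_of_mem_unitary hU]

/-- Commuting unitaries are contained in a commutative C⋆-algebra of operators. -/
lemma exists_commCStarAlgebra {U V : K →L[ℂ] K} (hU : U ∈ unitary (K →L[ℂ] K))
    (hV : V ∈ unitary (K →L[ℂ] K)) (hUV : Commute U V) :
    ∃ (C : Type u) (_ : CommCStarAlgebra C) (ρ : C →⋆ₐ[ℂ] (K →L[ℂ] K)) (u v : C),
      ρ u = U ∧ ρ v = V ∧ ‖u‖ ≤ 1 ∧ ‖v‖ ≤ 1 ∧ ‖(1 : C)‖ ≤ 1 := by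
  set s : Set (K →L[ℂ] K) := {U, V} with hs
  -- The adjoint of a unitary is its inverse, so no appeal to Fuglede's theorem is needed.
  have hstar : ∀ {X W : K →L[ℂ] K}, W ∈ unitary (K →L[ℂ] K) → Commute X W → Commute X (star W) :=
    fun hW h => Commute.units_inv_right (u := Unitary.toUnits ⟨_, hW⟩) h
  have hcomm : ∀ x ∈ s, ∀ y ∈ s, y * x = x * y := by
    rintro x (rfl | rfl) y (rfl | rfl)
    exacts [rfl, hUV.symm.eq, hUV.eq, rfl]
  have hcomm_star : ∀ x ∈ s, ∀ y ∈ s, y * star x = star x * y := by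
    rintro x (rfl | rfl) y (rfl | rfl)
    exacts [(hstar hU (Commute.refl _)).eq, (hstar hU hUV.symm).eq, (hstar hV hUV).eq,
      (hstar hV (Commute.refl _)).eq]
  set A : StarSubalgebra ℂ (K →L[ℂ] K) :=
    StarSubalgebra.centralizer ℂ (StarSubalgebra.centralizer ℂ s : Set (K →L[ℂ] K)) with hA
  have hAcoe : (A : Set (K →L[ℂ] K)) = (s ∪ star s).centralizer.centralizer :=
    StarSubalgebra.coe_centralizer_centralizer ℂ s
  have hmem : ∀ x ∈ s, x ∈ A := fun x hx => by
    rw [← SetLike.mem_coe, hAcoe]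
    exact Set.subset_centralizer_centralizer (Or.inl hx)
  have hclosed : IsClosed (A : Set (K →L[ℂ] K)) := by
    rw [hAcoe]
    exact Set.isClosed_centralizer _
  have hmul : ∀ x y : A, x * y = y * x := fun x y => Subtype.ext <| by
    have hx := x.2
    have hy := y.2
    rw [← SetLike.mem_coe, hAcoe] at hx hy
    exact Set.centralizer_centralizer_comm_of_comm
      (fun a ha b hb => Set.union_star_self_comm hcomm hcomm_star b hb a ha) _ hx _ hy
  let inst : CommCStarAlgebra A :=
    { StarSubalgebra.cstarAlgebra A (h_closed := hclosed) with mul_comm := hmul }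
  exact ⟨A, inst, A.subtype, ⟨U, hmem U (Or.inl rfl)⟩, ⟨V, hmem V (Or.inr rfl)⟩, rfl, rfl,
    norm_unitary_le hU, norm_unitary_le hV, ContinuousLinearMap.norm_id_le⟩

/-- **Von Neumann's inequality** for matrices of rational functions of two commuting unitaries. -/
theorem norm_matrixOperator_ratEval_le_of_unitary {U V : K →L[ℂ] K}
    (hU : U ∈ unitary (K →L[ℂ] K)) (hV : V ∈ unitary (K →L[ℂ] K)) (hUV : Commute U V)
    (p q : Matrix ι ι (MvPolynomial (Fin 3) ℂ))
    (hq : ∀ i j, ∀ z ∈ bidiscGraph, (q i j).eval z ≠ 0) {M : ℝ} (hM0 : 0 ≤ M)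
    (hM : ∀ z ∈ bidiscGraph, ‖Matrix.toEuclideanCLM (n := ι) (𝕜 := ℂ)
      (Matrix.of fun i j => (p i j).eval z / (q i j).eval z)‖ ≤ M) :
    ‖matrixOperator (Matrix.of fun i j => ratEval (graphTriple U V) (p i j) (q i j))‖ ≤ M := by
  obtain ⟨C, _, ρ, u, v, rfl, rfl, hu, hv, h1⟩ := exists_commCStarAlgebra hU hV hUV
  have hunit := fun i j => isUnit_aeval_graphTriple h1 hu hv (hq i j)
  have hF : (Matrix.of fun i j => ratEval (graphTriple (ρ u) (ρ v)) (p i j) (q i j)) =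
      (Matrix.of fun i j => commRatEval u v (p i j) (q i j)).map ρ := by
    ext1 i j
    exact ratEval_map ρ.toAlgHom u v (hunit i j) (p i j)
  rw [hF]
  refine norm_matrixOperator_map_le ρ _ hM0 fun χ => ?_
  convert hM _ (algHom_graphTriple_mem h1 hu hv χ.toAlgHom) using 3
  ext i j
  exact algHom_commRatEval (hunit i j) (p i j) χ.toAlgHom

end Unitary

/-! ### Passing from unitaries to their compressions. -/

section Compression

variable {K : Type*} [NormedAddCommGroup K] [InnerProductSpace ℂ K]
  {H : Type*} [NormedAddCommGroup H] [InnerProductSpace ℂ H]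
  {ι : Type*} [Fintype ι] [DecidableEq ι]

/-- The pairs `(X, Y)` of operators such that `X` leaves `ker C` invariant and `Y` is the
compression of `X` along the isometry `J`, whose range is fixed by the idempotent `C`. -/
def compressionAlgebra (C : K →L[ℂ] K) (hCC : C * C = C) (J : H →L[ℂ] K) (hCJ : C ∘L J = J) :
    Subalgebra ℂ ((K →L[ℂ] K) × (H →L[ℂ] H)) where
  carrier := {X | C * X.1 * C = C * X.1 ∧ (C * X.1) ∘L J = J ∘L X.2}
  mul_mem' := by
    rintro ⟨X, Y⟩ ⟨X', Y'⟩ ⟨h1, h2⟩ ⟨h1', h2'⟩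
    refine ⟨?_, ?_⟩
    · simp only [Prod.mk_mul_mk] at *
      rw [← mul_assoc, ← h1, mul_assoc (C * X), mul_assoc (C * X), h1']
    · simp only [Prod.mk_mul_mk] at *
      ext x
      have e1 := congrArg (fun Z : H →L[ℂ] K => Z x) h2'
      have e2 := congrArg (fun Z : H →L[ℂ] K => Z (Y' x)) h2
      have e3 := congrArg (fun Z : K →L[ℂ] K => Z (X' (J x))) h1
      simp only [ContinuousLinearMap.comp_apply, mul_apply_eq_comp] at e1 e2 e3 ⊢
      rw [← e3, e1, e2]
  add_mem' := by
    rintro ⟨X, Y⟩ ⟨X', Y'⟩ ⟨h1, h2⟩ ⟨h1', h2'⟩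
    simp only [Prod.mk_add_mk, Set.mem_ofPred_eq] at *
    refine ⟨by rw [mul_add, add_mul, h1, h1'], ?_⟩
    rw [mul_add, ContinuousLinearMap.add_comp, ContinuousLinearMap.comp_add, h2, h2']
  algebraMap_mem' c := by
    simp only [Set.mem_ofPred_eq, Algebra.algebraMap_eq_smul_one]
    refine ⟨by simp [hCC], ?_⟩
    ext x
    have := congrArg (fun Z : H →L[ℂ] K => Z x) hCJ
    simp only [ContinuousLinearMap.comp_apply] at this
    simp [this]

lemma mem_compressionAlgebra {C : K →L[ℂ] K} {hCC : C * C = C} {J : H →L[ℂ] K}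
    {hCJ : C ∘L J = J} {X : (K →L[ℂ] K) × (H →L[ℂ] H)} :
    X ∈ compressionAlgebra C hCC J hCJ ↔
      C * X.1 * C = C * X.1 ∧ (C * X.1) ∘L J = J ∘L X.2 := Iff.rfl

lemma isClosed_compressionAlgebra {C : K →L[ℂ] K} (hCC : C * C = C) {J : H →L[ℂ] K}
    (hCJ : C ∘L J = J) :
    IsClosed (compressionAlgebra C hCC J hCJ : Set ((K →L[ℂ] K) × (H →L[ℂ] H))) := by
  have h : (compressionAlgebra C hCC J hCJ : Set ((K →L[ℂ] K) × (H →L[ℂ] H))) =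
      {X | C * X.1 * C = C * X.1} ∩ {X | (C * X.1) ∘L J = J ∘L X.2} := rfl
  rw [h]
  exact (isClosed_eq (by fun_prop) (by fun_prop)).inter (isClosed_eq (by fun_prop) (by fun_prop))

/-- If the commuting contractions `A`, `B` are compressions of commuting unitaries, in the sense
that makes compression multiplicative, then they satisfy von Neumann's inequality. -/
theorem norm_matrixOperator_ratEval_le_of_compression [CompleteSpace K] [CompleteSpace H]
    {C : K →L[ℂ] K} (hCC : C * C = C) (hC : ∀ x, ‖C x‖ ≤ ‖x‖) (J : H →ₗᵢ[ℂ] K)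
    (hCJ : C ∘L J.toContinuousLinearMap = J.toContinuousLinearMap) {U V : K →L[ℂ] K}
    (hU : U ∈ unitary (K →L[ℂ] K)) (hV : V ∈ unitary (K →L[ℂ] K)) (hUV : Commute U V)
    {A B : H →L[ℂ] H} (hA : ‖A‖ ≤ 1) (hB : ‖B‖ ≤ 1) (hAB : Commute A B)
    (hUA : (U, A) ∈ compressionAlgebra C hCC J.toContinuousLinearMap hCJ)
    (hVB : (V, B) ∈ compressionAlgebra C hCC J.toContinuousLinearMap hCJ)
    (p q : Matrix ι ι (MvPolynomial (Fin 3) ℂ))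
    (hq : ∀ i j, ∀ z ∈ bidiscGraph, (q i j).eval z ≠ 0) {M : ℝ} (hM0 : 0 ≤ M)
    (hM : ∀ z ∈ bidiscGraph, ‖Matrix.toEuclideanCLM (n := ι) (𝕜 := ℂ)
      (Matrix.of fun i j => (p i j).eval z / (q i j).eval z)‖ ≤ M) :
    ‖matrixOperator (Matrix.of fun i j => ratEval (graphTriple A B) (p i j) (q i j))‖ ≤ M := by
  set R := (K →L[ℂ] K) × (H →L[ℂ] H)
  set s : Set R := {(U, A), (V, B)} with hs
  have hcomm : ∀ x ∈ s, ∀ y ∈ s, y * x = x * y := by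
    rintro x (rfl | rfl) y (rfl | rfl)
    exacts [rfl, Prod.ext hUV.symm.eq hAB.symm.eq, Prod.ext hUV.eq hAB.eq, rfl]
  -- Intersecting with the double commutant makes `D` commutative, and `D` is closed. Denominators
  -- are therefore invertible within `D`, so rational functions of the pairs again consist of an
  -- operator and its compression.
  set D : Subalgebra ℂ R := compressionAlgebra C hCC J.toContinuousLinearMap hCJ ⊓
    Subalgebra.centralizer ℂ (Subalgebra.centralizer ℂ s : Set R) with hD
  have hDc : (D : Set R) = (compressionAlgebra C hCC J.toContinuousLinearMap hCJ : Set R) ∩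
    s.centralizer.centralizer := rfl
  have hclosed : IsClosed (D : Set R) :=
    (isClosed_compressionAlgebra hCC hCJ).inter (Set.isClosed_centralizer _)
  have hmul : ∀ x y : D, x * y = y * x := fun x y => Subtype.ext <|
    Set.centralizer_centralizer_comm_of_comm (fun a ha b hb => hcomm b hb a ha)
      _ x.2.2 _ y.2.2
  let inst : NormedCommRing D := { (inferInstance : NormedRing D) with mul_comm := hmul }
  have : CompleteSpace D := hclosed.completeSpace_coe
  let a : D := ⟨(U, A), hUA, Set.subset_centralizer_centralizer (Or.inl rfl)⟩
  let b : D := ⟨(V, B), hVB, Set.subset_centralizer_centralizer (Or.inr rfl)⟩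
  have h1 : ‖(1 : D)‖ ≤ 1 := max_le ContinuousLinearMap.norm_id_le ContinuousLinearMap.norm_id_le
  have ha : ‖a‖ ≤ 1 := max_le (norm_unitary_le hU) hA
  have hb : ‖b‖ ≤ 1 := max_le (norm_unitary_le hV) hB
  let π₁ : D →ₐ[ℂ] (K →L[ℂ] K) := (AlgHom.fst ℂ _ _).comp D.val
  let π₂ : D →ₐ[ℂ] (H →L[ℂ] H) := (AlgHom.snd ℂ _ _).comp D.val
  have hunit := fun i j => isUnit_aeval_graphTriple h1 ha hb (hq i j)
  have hbound := norm_matrixOperator_ratEval_le_of_unitary hU hV hUV p q hq hM0 hM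
  have e1 : ∀ i j, ratEval (graphTriple U V) (p i j) (q i j) = π₁ (commRatEval a b (p i j) (q i j)) :=
    fun i j => ratEval_map π₁ a b (hunit i j) (p i j)
  have e2 : ∀ i j, ratEval (graphTriple A B) (p i j) (q i j) = π₂ (commRatEval a b (p i j) (q i j)) :=
    fun i j => ratEval_map π₂ a b (hunit i j) (p i j)
  simp only [e1, e2] at hbound ⊢
  set F : ι → ι → D := fun i j => commRatEval a b (p i j) (q i j)
  refine ContinuousLinearMap.opNorm_le_bound _ hM0 fun x => ?_
  set y : PiLp 2 (fun _ : ι => K) := WithLp.toLp 2 fun i => J (x i) with hy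
  have hyx : ‖y‖ = ‖x‖ := by
    rw [PiLp.norm_eq_of_L2, PiLp.norm_eq_of_L2]
    simp [hy]
  rw [← hyx]
  refine le_trans ?_ (ContinuousLinearMap.le_of_opNorm_le _ hbound y)
  rw [PiLp.norm_eq_of_L2, PiLp.norm_eq_of_L2]
  refine Real.sqrt_le_sqrt (Finset.sum_le_sum fun i _ => pow_le_pow_left₀ (norm_nonneg _) ?_ 2)
  rw [matrixOperator_apply, matrixOperator_apply, ← J.norm_map]
  refine le_trans (le_of_eq ?_) (hC _)
  congr 1
  rw [map_sum, map_sum]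
  refine Finset.sum_congr rfl fun j _ => ?_
  -- Membership in `compressionAlgebra` says `C X J = J Y` for the two components `X`, `Y` of `F i
  -- j`.
  exact (congrArg (fun Z : H →L[ℂ] K => Z (x j)) (F i j).2.1.2).symm

/-- A rational function without poles in the closed bidisc can be evaluated at commuting
contractions. -/
lemma isUnit_polyEval_graphTriple [CompleteSpace H] {A B : H →L[ℂ] H} (hA : ‖A‖ ≤ 1)
    (hB : ‖B‖ ≤ 1) (hAB : Commute A B) {q : MvPolynomial (Fin 3) ℂ}
    (hq : ∀ z ∈ bidiscGraph, q.eval z ≠ 0) : IsUnit (polyEval (graphTriple A B) q) := by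
  set s : Set (H →L[ℂ] H) := {A, B} with hs
  have hcomm : ∀ x ∈ s, ∀ y ∈ s, x * y = y * x := by
    rintro x (rfl | rfl) y (rfl | rfl)
    exacts [rfl, hAB.eq, hAB.symm.eq, rfl]
  set D : Subalgebra ℂ (H →L[ℂ] H) :=
    Subalgebra.centralizer ℂ (Subalgebra.centralizer ℂ s : Set (H →L[ℂ] H)) with hD
  have hclosed : IsClosed (D : Set (H →L[ℂ] H)) := Set.isClosed_centralizer _
  have hmul : ∀ x y : D, x * y = y * x := fun x y => Subtype.ext <|
    Set.centralizer_centralizer_comm_of_comm hcomm _ x.2 _ y.2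
  let inst : NormedCommRing D := { (inferInstance : NormedRing D) with mul_comm := hmul }
  have : CompleteSpace D := hclosed.completeSpace_coe
  let a : D := ⟨A, Set.subset_centralizer_centralizer (Or.inl rfl)⟩
  let b : D := ⟨B, Set.subset_centralizer_centralizer (Or.inr rfl)⟩
  have hunit := isUnit_aeval_graphTriple (a := a) (b := b) ContinuousLinearMap.norm_id_le hA hB hq
  have h := polyEval_map D.val (graphTriple a b) q
  rw [map_graphTriple D.val] at h
  exact h ▸ hunit.map D.val

end Compression

/-! ### Shifts and diagonal operators on two-sided square summable sequences. -/

section SequenceSpace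

/-- The Hilbert space of square summable two-sided sequences in `E`. -/
abbrev BiSeq (E : Type*) [NormedAddCommGroup E] : Type _ := lp (fun _ : ℤ => E) 2

lemma BiSeq.hasSum_norm_sq {E : Type*} [NormedAddCommGroup E] (f : BiSeq E) :
    HasSum (fun n => ‖f n‖ ^ 2) (‖f‖ ^ 2) := by
  have := lp.hasSum_norm (p := 2) (by norm_num) f
  simpa using this

lemma memℓp_two_iff {E : Type*} [NormedAddCommGroup E] {f : ℤ → E} :
    Memℓp f 2 ↔ Summable fun n => ‖f n‖ ^ 2 := by
  rw [memℓp_gen_iff (by norm_num)]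
  simp

lemma BiSeq.hasSum_norm_sq_shift {E : Type*} [NormedAddCommGroup E] (k : ℤ) (f : BiSeq E) :
    HasSum (fun n => ‖f (n + k)‖ ^ 2) (‖f‖ ^ 2) :=
  ((Equiv.addRight k).hasSum_iff (f := fun n => ‖f n‖ ^ 2)).2 f.hasSum_norm_sq

lemma norm_shift_le {E : Type*} [NormedAddCommGroup E] (k : ℤ) (f g : BiSeq E)
    (hg : ∀ n, g n = f (n + k)) : ‖g‖ ≤ 1 * ‖f‖ := by
  rw [one_mul, ← sq_le_sq₀ (norm_nonneg _) (norm_nonneg _)]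
  have h := g.hasSum_norm_sq
  simp only [hg] at h
  exact (h.unique (f.hasSum_norm_sq_shift k)).le

variable {E : Type*} [NormedAddCommGroup E] [InnerProductSpace ℂ E]

lemma summable_norm_sq_diagonal {a : ℤ → E →L[ℂ] E} {c : ℝ} (ha : ∀ n, ‖a n‖ ≤ c) (f : BiSeq E) :
    Summable fun n => ‖a n (f n)‖ ^ 2 := by
  refine Summable.of_nonneg_of_le (fun n => by positivity)
    (fun n => pow_le_pow_left₀ (norm_nonneg _) ((a n).le_of_opNorm_le (ha n) (f n)) 2) ?_
  simp only [mul_pow]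
  exact f.hasSum_norm_sq.summable.mul_left _

lemma norm_diagonal_le {a : ℤ → E →L[ℂ] E} {c : ℝ} (ha : ∀ n, ‖a n‖ ≤ c) (f g : BiSeq E)
    (hg : ∀ n, g n = a n (f n)) : ‖g‖ ≤ c * ‖f‖ := by
  have hc : 0 ≤ c := (norm_nonneg _).trans (ha 0)
  rw [← sq_le_sq₀ (norm_nonneg _) (by positivity), mul_pow]
  refine hasSum_le (fun n => ?_) g.hasSum_norm_sq (f.hasSum_norm_sq.mul_left (c ^ 2))
  rw [hg, ← mul_pow]
  exact pow_le_pow_left₀ (norm_nonneg _) ((a n).le_of_opNorm_le (ha n) (f n)) 2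

/-- The operator on sequences that applies `a n` to the `n`-th term. -/
def diagonalOp (a : ℤ → E →L[ℂ] E) {c : ℝ} (ha : ∀ n, ‖a n‖ ≤ c) : BiSeq E →L[ℂ] BiSeq E :=
  LinearMap.mkContinuous
    { toFun := fun f => ⟨fun n => a n (f n), memℓp_two_iff.2 (summable_norm_sq_diagonal ha f)⟩
      map_add' := fun f g => Subtype.ext (funext fun n => map_add (a n) (f n) (g n))
      map_smul' := fun r f => Subtype.ext (funext fun n => map_smul (a n) r (f n)) } c
    fun f => norm_diagonal_le ha f _ fun _ => rfl

lemma diagonalOp_apply (a : ℤ → E →L[ℂ] E) {c : ℝ} (ha : ∀ n, ‖a n‖ ≤ c) (f : BiSeq E) (n : ℤ) :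
    diagonalOp a ha f n = a n (f n) := rfl

/-- The shift by `k` on sequences. -/
def shiftOp (E : Type*) [NormedAddCommGroup E] [InnerProductSpace ℂ E] (k : ℤ) :
    BiSeq E →L[ℂ] BiSeq E :=
  LinearMap.mkContinuous
    { toFun := fun f => ⟨fun n => f (n + k), memℓp_two_iff.2 (f.hasSum_norm_sq_shift k).summable⟩
      map_add' := fun _ _ => rfl
      map_smul' := fun _ _ => rfl } 1
    fun f => norm_shift_le k f _ fun _ => rfl

lemma shiftOp_apply (k : ℤ) (f : BiSeq E) (n : ℤ) : shiftOp E k f n = f (n + k) := rfl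

/-- The operator that applies `a` to every term of a sequence. -/
def constOp (a : E →L[ℂ] E) : BiSeq E →L[ℂ] BiSeq E := diagonalOp (fun _ => a) fun _ => le_rfl

lemma constOp_apply (a : E →L[ℂ] E) (f : BiSeq E) (n : ℤ) : constOp a f n = a (f n) := rfl

lemma constOp_mul (a b : E →L[ℂ] E) : constOp (a * b) = constOp a * constOp b := by
  ext f n; rfl

lemma constOp_one : constOp (1 : E →L[ℂ] E) = 1 := by
  ext f n; rfl

lemma shiftOp_mul_constOp (k : ℤ) (a : E →L[ℂ] E) :
    shiftOp E k * constOp a = constOp a * shiftOp E k := by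
  ext f n; rfl

lemma shiftOp_mul_neg (k : ℤ) : shiftOp E k * shiftOp E (-k) = 1 := by
  ext f n
  simp [shiftOp_apply]

variable [CompleteSpace E]

lemma star_constOp (a : E →L[ℂ] E) : star (constOp a) = constOp (star a) := by
  rw [ContinuousLinearMap.star_eq_adjoint]
  symm
  rw [ContinuousLinearMap.eq_adjoint_iff]
  intro f g
  rw [lp.inner_eq_tsum, lp.inner_eq_tsum]
  refine tsum_congr fun n => ?_
  rw [constOp_apply, constOp_apply, ContinuousLinearMap.star_eq_adjoint,
    ContinuousLinearMap.adjoint_inner_left]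

lemma star_shiftOp (k : ℤ) : star (shiftOp E k) = shiftOp E (-k) := by
  rw [ContinuousLinearMap.star_eq_adjoint]
  symm
  rw [ContinuousLinearMap.eq_adjoint_iff]
  intro f g
  rw [lp.inner_eq_tsum, lp.inner_eq_tsum, ← (Equiv.addRight k).tsum_eq]
  refine tsum_congr fun n => ?_
  simp [shiftOp_apply]

end SequenceSpace

/-! ### The orbit embedding of `H` into sequences. -/

section Dilation

variable {E : Type*} [NormedAddCommGroup E] [InnerProductSpace ℂ E]

lemma norm_ite_one_le (n : ℤ) : ‖(if 0 ≤ n then 1 else 0 : E →L[ℂ] E)‖ ≤ 1 := by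
  split_ifs
  · exact ContinuousLinearMap.norm_id_le
  · simp

/-- The projection of two-sided sequences onto those supported on the nonnegative integers. -/
def truncOp (E : Type*) [NormedAddCommGroup E] [InnerProductSpace ℂ E] : BiSeq E →L[ℂ] BiSeq E :=
  diagonalOp (fun n => if 0 ≤ n then 1 else 0) norm_ite_one_le

lemma truncOp_apply_of_nonneg (f : BiSeq E) {n : ℤ} (hn : 0 ≤ n) : truncOp E f n = f n := by
  rw [truncOp, diagonalOp_apply, if_pos hn]; rfl

lemma truncOp_apply_of_neg (f : BiSeq E) {n : ℤ} (hn : ¬ 0 ≤ n) : truncOp E f n = 0 := by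
  rw [truncOp, diagonalOp_apply, if_neg hn]; rfl

lemma truncOp_mul_self : truncOp E * truncOp E = truncOp E := by
  ext f n
  by_cases hn : 0 ≤ n
  · exact truncOp_apply_of_nonneg _ hn
  · exact (truncOp_apply_of_neg _ hn).trans (truncOp_apply_of_neg f hn).symm

lemma norm_truncOp_apply_le (f : BiSeq E) : ‖truncOp E f‖ ≤ ‖f‖ := by
  have h := norm_diagonal_le norm_ite_one_le f (truncOp E f) fun _ => rfl
  rwa [one_mul] at h

variable {H : Type*} [NormedAddCommGroup H] [InnerProductSpace ℂ H]

/-- The series telescopes, and `Tⁿ h → 0` because `T` is a strict contraction. -/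
lemma hasSum_norm_sq_sub {T : H →L[ℂ] H} (hT : ‖T‖ < 1) (h : H) (g : ℕ → ℝ) (hg0 : ∀ n, 0 ≤ g n)
    (hg : ∀ n, g n = ‖(T ^ n) h‖ ^ 2 - ‖(T ^ (n + 1)) h‖ ^ 2) : HasSum g (‖h‖ ^ 2) := by
  rw [hasSum_iff_tendsto_nat_of_nonneg hg0]
  simp only [hg, Finset.sum_range_sub' fun n => ‖(T ^ n) h‖ ^ 2]
  have h0 : Filter.Tendsto (fun n => ‖(T ^ n) h‖) Filter.atTop (nhds 0) := by
    have h1 := (tendsto_pow_atTop_nhds_zero_of_lt_one (norm_nonneg T) hT).mul_const ‖h‖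
    rw [zero_mul] at h1
    refine squeeze_zero' (Filter.Eventually.of_forall fun n => norm_nonneg _) ?_ h1
    filter_upwards [Filter.eventually_gt_atTop 0] with n hn
    exact (T ^ n).le_of_opNorm_le (norm_pow_le' T hn) h
  have h2 := (h0.pow 2).const_sub (‖h‖ ^ 2)
  simpa using h2

/-- The sequence `e h, e (T h), e (T² h), …`, extended by zero to negative indices. -/
def orbitSeq (e : H →L[ℂ] E) (T : H →L[ℂ] H) (h : H) (n : ℤ) : E :=
  if 0 ≤ n then e ((T ^ n.toNat) h) else 0

lemma hasSum_orbitSeq {e : H →L[ℂ] E} {T : H →L[ℂ] H} (hT : ‖T‖ < 1)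
    (he : ∀ h, ‖e h‖ ^ 2 = ‖h‖ ^ 2 - ‖T h‖ ^ 2) (h : H) :
    HasSum (fun n => ‖orbitSeq e T h n‖ ^ 2) (‖h‖ ^ 2) := by
  rw [← Function.Injective.hasSum_iff (Nat.cast_injective (R := ℤ))]
  · refine hasSum_norm_sq_sub hT h _ (fun n => sq_nonneg _) fun n => ?_
    simp only [Function.comp_apply, orbitSeq, Nat.cast_nonneg, if_true, Int.toNat_natCast, he]
    rw [pow_succ' T]
    rfl
  · intro n hn
    have : ¬ 0 ≤ n := fun h0 => hn ⟨n.toNat, Int.toNat_of_nonneg h0⟩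
    simp [orbitSeq, this]

/-- The isometry `h ↦ (e h, e (T h), e (T² h), …)`. -/
def orbitIsometry {e : H →L[ℂ] E} {T : H →L[ℂ] H} (hT : ‖T‖ < 1)
    (he : ∀ h, ‖e h‖ ^ 2 = ‖h‖ ^ 2 - ‖T h‖ ^ 2) : H →ₗᵢ[ℂ] BiSeq E where
  toFun h := ⟨orbitSeq e T h, memℓp_two_iff.2 (hasSum_orbitSeq hT he h).summable⟩
  map_add' x y := by
    ext n
    change orbitSeq e T (x + y) n = orbitSeq e T x n + orbitSeq e T y n
    unfold orbitSeq
    split_ifs <;> simp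
  map_smul' c x := by
    ext n
    change orbitSeq e T (c • x) n = c • orbitSeq e T x n
    unfold orbitSeq
    split_ifs <;> simp
  norm_map' h := by
    rw [← sq_eq_sq₀ (norm_nonneg _) (norm_nonneg _)]
    exact (BiSeq.hasSum_norm_sq _).unique (hasSum_orbitSeq hT he h)

lemma orbitIsometry_apply_of_nonneg {e : H →L[ℂ] E} {T : H →L[ℂ] H} (hT : ‖T‖ < 1)
    (he : ∀ h, ‖e h‖ ^ 2 = ‖h‖ ^ 2 - ‖T h‖ ^ 2) (h : H) {n : ℤ} (hn : 0 ≤ n) :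
    orbitIsometry hT he h n = e ((T ^ n.toNat) h) := if_pos hn

lemma orbitIsometry_apply_of_neg {e : H →L[ℂ] E} {T : H →L[ℂ] H} (hT : ‖T‖ < 1)
    (he : ∀ h, ‖e h‖ ^ 2 = ‖h‖ ^ 2 - ‖T h‖ ^ 2) (h : H) {n : ℤ} (hn : ¬ 0 ≤ n) :
    orbitIsometry hT he h n = 0 := if_neg hn

lemma truncOp_comp_orbitIsometry {e : H →L[ℂ] E} {T : H →L[ℂ] H} (hT : ‖T‖ < 1)
    (he : ∀ h, ‖e h‖ ^ 2 = ‖h‖ ^ 2 - ‖T h‖ ^ 2) :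
    truncOp E ∘L (orbitIsometry hT he).toContinuousLinearMap =
      (orbitIsometry hT he).toContinuousLinearMap := by
  ext h n
  by_cases hn : 0 ≤ n
  · exact truncOp_apply_of_nonneg _ hn
  · exact (truncOp_apply_of_neg _ hn).trans (orbitIsometry_apply_of_neg hT he h hn).symm

/-- Truncation kills negative indices on both sides, so only `n ≥ 0` matters. The condition `h1`
expresses that `X` preserves the kernel of `truncOp`. -/
lemma mem_compressionAlgebra_orbitIsometry {e : H →L[ℂ] E} {T : H →L[ℂ] H} (hT : ‖T‖ < 1)
    (he : ∀ h, ‖e h‖ ^ 2 = ‖h‖ ^ 2 - ‖T h‖ ^ 2) {X : BiSeq E →L[ℂ] BiSeq E} {Y : H →L[ℂ] H}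
    (h1 : ∀ (f : BiSeq E) (n : ℤ), 0 ≤ n → X (truncOp E f) n = X f n)
    (h2 : ∀ (h : H) (n : ℤ), 0 ≤ n → X (orbitIsometry hT he h) n = orbitIsometry hT he (Y h) n) :
    (X, Y) ∈ compressionAlgebra (truncOp E) truncOp_mul_self
      (orbitIsometry hT he).toContinuousLinearMap (truncOp_comp_orbitIsometry hT he) := by
  rw [mem_compressionAlgebra]
  constructor
  · ext f n
    by_cases hn : 0 ≤ n
    · exact (truncOp_apply_of_nonneg _ hn).trans
        ((h1 f n hn).trans (truncOp_apply_of_nonneg _ hn).symm)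
    · exact (truncOp_apply_of_neg _ hn).trans (truncOp_apply_of_neg _ hn).symm
  · ext h n
    by_cases hn : 0 ≤ n
    · exact (truncOp_apply_of_nonneg _ hn).trans (h2 h n hn)
    · exact (truncOp_apply_of_neg _ hn).trans (orbitIsometry_apply_of_neg hT he _ hn).symm

lemma orbitIsometry_apply_add_one {e : H →L[ℂ] E} {T : H →L[ℂ] H} (hT : ‖T‖ < 1)
    (he : ∀ h, ‖e h‖ ^ 2 = ‖h‖ ^ 2 - ‖T h‖ ^ 2) (h : H) {n : ℤ} (hn : 0 ≤ n) :
    orbitIsometry hT he h (n + 1) = e (T ((T ^ n.toNat) h)) := by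
  rw [orbitIsometry_apply_of_nonneg hT he h (by omega), Int.toNat_add hn zero_le_one,
    show (1 : ℤ).toNat = 1 from rfl, pow_succ']
  rfl

lemma orbitIsometry_apply_commute {e : H →L[ℂ] E} {T Y : H →L[ℂ] H} (hT : ‖T‖ < 1)
    (he : ∀ h, ‖e h‖ ^ 2 = ‖h‖ ^ 2 - ‖T h‖ ^ 2) (hY : Commute Y T) (h : H) {n : ℤ} (hn : 0 ≤ n) :
    orbitIsometry hT he (Y h) n = e (Y ((T ^ n.toNat) h)) := by
  rw [orbitIsometry_apply_of_nonneg hT he _ hn]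
  exact congrArg (fun Z : H →L[ℂ] H => e (Z h)) (hY.pow_right _).symm.eq

end Dilation

/-! ### Unitaries of the form `PS + (1 - P)`. -/

section Twist

variable {R : Type*} [Ring R] [StarRing R] {P S W : R}

lemma twist_mul_star (hP : IsStarProjection P) (hS : S ∈ unitary R) (hSP : Commute S P) :
    (P * S + (1 - P)) * (P * star S + (1 - P)) = 1 := by
  have hPP : P * P = P := hP.isIdempotentElem.eq
  have h1 : P * S * (P * star S) = P := by
    rw [← hSP.eq, mul_assoc, ← mul_assoc P, hPP, ← mul_assoc, hSP.eq, mul_assoc,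
      (Unitary.mem_iff.1 hS).2, mul_one]
  have h2 : P * S * (1 - P) = 0 := by
    rw [mul_sub, mul_one, mul_assoc, hSP.eq, ← mul_assoc, hPP, sub_self]
  have h3 : (1 - P) * (P * star S) = 0 := by
    rw [← mul_assoc, sub_mul, one_mul, hPP, sub_self, zero_mul]
  have h4 : (1 - P) * (1 - P) = 1 - P := hP.isIdempotentElem.one_sub.eq
  rw [mul_add, add_mul, add_mul, h1, h2, h3, h4]
  abel

lemma star_twist (hP : IsStarProjection P) (hSP : Commute S P) :
    star (P * S + (1 - P)) = P * star S + (1 - P) := by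
  have hPs : star P = P := hP.isSelfAdjoint.star_eq
  have h := hSP.star_star.eq
  rw [hPs] at h
  rw [star_add, star_mul, star_sub, star_one, hPs, h]

lemma twist_mem_unitary (hP : IsStarProjection P) (hS : S ∈ unitary R) (hSP : Commute S P) :
    P * S + (1 - P) ∈ unitary R := by
  have hSP' : Commute (star S) P := by
    simpa [hP.isSelfAdjoint.star_eq] using hSP.star_star
  rw [Unitary.mem_iff, star_twist hP hSP]
  refine ⟨?_, twist_mul_star hP hS hSP⟩
  simpa using twist_mul_star hP (Unitary.star_mem hS) hSP'

lemma commute_twist {R : Type*} [Ring R] {P S W : R} (hSP : Commute S P) (hSW : Commute S W) :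
    Commute S (W * (P * S + (1 - P))) :=
  hSW.mul_right ((hSP.mul_right (Commute.refl S)).add_right
    ((Commute.one_right S).sub_right hSP))

/-- Both products equal `S`: a unitary commuting with `S` yields a factorization of `S` into
commuting factors. -/
lemma commute_star_mul {U : R} (hU : U ∈ unitary R) (hSU : Commute S U) :
    Commute U (star U * S) := by
  change U * (star U * S) = star U * S * U
  rw [mul_assoc, hSU.eq, ← mul_assoc, ← mul_assoc, (Unitary.mem_iff.1 hU).1,
    (Unitary.mem_iff.1 hU).2]

end Twist

/-! ### Commuting unitaries whose product is the shift. -/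

section Model

variable {E : Type*} [NormedAddCommGroup E] [InnerProductSpace ℂ E] [CompleteSpace E]

lemma isStarProjection_constOp {p : E →L[ℂ] E} (hp : IsStarProjection p) :
    IsStarProjection (constOp p) :=
  ⟨by rw [IsIdempotentElem, ← constOp_mul, hp.isIdempotentElem.eq],
    by rw [IsSelfAdjoint, star_constOp, hp.isSelfAdjoint.star_eq]⟩

lemma constOp_mem_unitary {W : E →L[ℂ] E} (hW : W ∈ unitary (E →L[ℂ] E)) :
    constOp W ∈ unitary (BiSeq E →L[ℂ] BiSeq E) := by
  rw [Unitary.mem_iff, star_constOp, ← constOp_mul, ← constOp_mul, (Unitary.mem_iff.1 hW).1,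
    (Unitary.mem_iff.1 hW).2, constOp_one]
  exact ⟨rfl, rfl⟩

lemma shiftOp_mem_unitary (k : ℤ) : shiftOp E k ∈ unitary (BiSeq E →L[ℂ] BiSeq E) := by
  rw [Unitary.mem_iff, star_shiftOp]
  exact ⟨by simpa using shiftOp_mul_neg (E := E) (-k), shiftOp_mul_neg k⟩

variable (W p : E →L[ℂ] E)

/-- The first unitary of Andô's construction. -/
def modelFst : BiSeq E →L[ℂ] BiSeq E :=
  constOp (star W) * (constOp p * shiftOp E 1 + (1 - constOp p))

/-- The second unitary of Andô's construction. -/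
def modelSnd : BiSeq E →L[ℂ] BiSeq E := star (modelFst W p) * shiftOp E 1

variable {W p}

lemma modelFst_mem_unitary (hW : W ∈ unitary (E →L[ℂ] E)) (hp : IsStarProjection p) :
    modelFst W p ∈ unitary (BiSeq E →L[ℂ] BiSeq E) :=
  mul_mem (constOp_mem_unitary (Unitary.star_mem hW))
    (twist_mem_unitary (isStarProjection_constOp hp) (shiftOp_mem_unitary 1)
      (shiftOp_mul_constOp 1 p))

lemma modelSnd_mem_unitary (hW : W ∈ unitary (E →L[ℂ] E)) (hp : IsStarProjection p) :
    modelSnd W p ∈ unitary (BiSeq E →L[ℂ] BiSeq E) :=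
  mul_mem (Unitary.star_mem (modelFst_mem_unitary hW hp)) (shiftOp_mem_unitary 1)

lemma commute_model (hW : W ∈ unitary (E →L[ℂ] E)) (hp : IsStarProjection p) :
    Commute (modelFst W p) (modelSnd W p) :=
  commute_star_mul (modelFst_mem_unitary hW hp)
    (commute_twist (shiftOp_mul_constOp 1 p) (shiftOp_mul_constOp 1 (star W)))

lemma modelFst_apply (f : BiSeq E) (n : ℤ) :
    modelFst W p f n = star W (p (f (n + 1)) + (1 - p) (f n)) := rfl

/-- In `(pS* + 1 - p) W S` the two shifts cancel on the range of `p`. Only indices `n` and `n + 1`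
remain, which is what lets the operator preserve the kernel of `truncOp`. -/
lemma modelSnd_apply (hp : IsStarProjection p) (f : BiSeq E) (n : ℤ) :
    modelSnd W p f n = p (W (f n)) + (1 - p) (W (f (n + 1))) := by
  have h : modelSnd W p =
      (constOp p * shiftOp E (-1) + (1 - constOp p)) * constOp W * shiftOp E 1 := by
    rw [modelSnd, modelFst, star_mul, star_constOp, star_star,
      star_twist (isStarProjection_constOp hp) (shiftOp_mul_constOp 1 p), star_shiftOp]
  rw [h]
  change p (W (f (n + -1 + 1))) + (1 - p) (W (f (n + 1))) = _
  rw [neg_add_cancel_right]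

variable {H : Type*} [NormedAddCommGroup H] [InnerProductSpace ℂ H] [CompleteSpace H]
  {ι : Type*} [Fintype ι] [DecidableEq ι]

end Model

section Model

variable {E : Type*} [NormedAddCommGroup E] [InnerProductSpace ℂ E] [CompleteSpace E]
  {W p : E →L[ℂ] E}
  {H : Type*} [NormedAddCommGroup H] [InnerProductSpace ℂ H] [CompleteSpace H]
  {ι : Type*} [Fintype ι] [DecidableEq ι]

/-- Von Neumann's inequality for `A`, `B`, given the unitary `W` of Andô's construction. -/
theorem norm_matrixOperator_ratEval_le_of_model
    {A B : H →L[ℂ] H} (hA : ‖A‖ ≤ 1) (hB : ‖B‖ ≤ 1) (hAB : Commute A B) (hT : ‖A * B‖ < 1)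
    {e : H →L[ℂ] E} (he : ∀ h, ‖e h‖ ^ 2 = ‖h‖ ^ 2 - ‖(A * B) h‖ ^ 2)
    (hW : W ∈ unitary (E →L[ℂ] E)) (hp : IsStarProjection p)
    (hWA : ∀ h, W (e (A h)) = p (e ((A * B) h)) + (1 - p) (e h))
    (hWB : ∀ h, p (W (e h)) + (1 - p) (W (e ((A * B) h))) = e (B h))
    (a b : Matrix ι ι (MvPolynomial (Fin 3) ℂ))
    (hb : ∀ i j, ∀ z ∈ bidiscGraph, (b i j).eval z ≠ 0) {M : ℝ} (hM0 : 0 ≤ M)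
    (hM : ∀ z ∈ bidiscGraph, ‖Matrix.toEuclideanCLM (n := ι) (𝕜 := ℂ)
      (Matrix.of fun i j => (a i j).eval z / (b i j).eval z)‖ ≤ M) :
    ‖matrixOperator (Matrix.of fun i j => ratEval (graphTriple A B) (a i j) (b i j))‖ ≤ M := by
  set J := orbitIsometry hT he with hJ
  have hmA : (modelFst W p, A) ∈ compressionAlgebra (truncOp E) truncOp_mul_self
      J.toContinuousLinearMap (truncOp_comp_orbitIsometry hT he) := by
    refine mem_compressionAlgebra_orbitIsometry hT he (fun f n hn => ?_) fun h n hn => ?_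
    · rw [modelFst_apply, modelFst_apply, truncOp_apply_of_nonneg _ hn,
        truncOp_apply_of_nonneg _ (by omega)]
    · rw [modelFst_apply, orbitIsometry_apply_add_one hT he h hn,
        orbitIsometry_apply_of_nonneg hT he _ hn, ← hWA,
        orbitIsometry_apply_commute hT he ((Commute.refl A).mul_right hAB) h hn]
      exact congrArg (fun Z : E →L[ℂ] E => Z (e (A (((A * B) ^ n.toNat) h))))
        (Unitary.mem_iff.1 hW).1
  have hmB : (modelSnd W p, B) ∈ compressionAlgebra (truncOp E) truncOp_mul_self
      J.toContinuousLinearMap (truncOp_comp_orbitIsometry hT he) := by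
    refine mem_compressionAlgebra_orbitIsometry hT he (fun f n hn => ?_) fun h n hn => ?_
    · rw [modelSnd_apply hp, modelSnd_apply hp, truncOp_apply_of_nonneg _ hn,
        truncOp_apply_of_nonneg _ (by omega)]
    · rw [modelSnd_apply hp, orbitIsometry_apply_add_one hT he h hn,
        orbitIsometry_apply_of_nonneg hT he _ hn, hWB,
        orbitIsometry_apply_commute hT he (hAB.symm.mul_right (Commute.refl B)) h hn]
  exact norm_matrixOperator_ratEval_le_of_compression (K := BiSeq E) (U := modelFst W p)
    (V := modelSnd W p) truncOp_mul_self norm_truncOp_apply_le J (truncOp_comp_orbitIsometry hT he)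
    (modelFst_mem_unitary hW hp)
    (modelSnd_mem_unitary hW hp) (commute_model hW hp) hA hB hAB hmA hmB a b hb hM0 hM

end Model

/-! ### Maps into a two-fold direct sum. -/

section DirectSum

variable {H X : Type*} [NormedAddCommGroup H] [InnerProductSpace ℂ H] [NormedAddCommGroup X]
  [InnerProductSpace ℂ X]

/-- The inclusion of the first summand in `X ⊕ X`. -/
def inclFst (X : Type*) [NormedAddCommGroup X] [InnerProductSpace ℂ X] :
    X →L[ℂ] PiLp 2 (fun _ : Fin 2 => X) :=
  (PiLp.continuousLinearEquiv 2 ℂ (fun _ : Fin 2 => X)).symm.toContinuousLinearMap.comp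
    (ContinuousLinearMap.pi ![1, 0])

lemma inclFst_zero (x : X) : inclFst X x 0 = x := by simp [inclFst]

lemma inclFst_one (x : X) : inclFst X x 1 = 0 := by simp [inclFst]

lemma norm_inclFst (x : X) : ‖inclFst X x‖ = ‖x‖ := by
  rw [PiLp.norm_eq_of_L2, Fin.sum_univ_two, inclFst_zero, inclFst_one]
  simp

/-- The operator `h ↦ (f h, g h)`. -/
def pairMap (f g : H →L[ℂ] H) : H →L[ℂ] PiLp 2 (fun _ : Fin 2 => H) :=
  (PiLp.continuousLinearEquiv 2 ℂ (fun _ : Fin 2 => H)).symm.toContinuousLinearMap.comp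
    (ContinuousLinearMap.pi ![f, g])

lemma pairMap_zero (f g : H →L[ℂ] H) (h : H) : pairMap f g h 0 = f h := by simp [pairMap]

lemma pairMap_one (f g : H →L[ℂ] H) (h : H) : pairMap f g h 1 = g h := by simp [pairMap]

end DirectSum

/-! ### Extending a partial isometry to a unitary on a doubled space. -/

section UnitaryExtension

open ContinuousLinearMap

variable {H : Type*} [NormedAddCommGroup H] [InnerProductSpace ℂ H] [CompleteSpace H]
  {X : Type*} [NormedAddCommGroup X] [InnerProductSpace ℂ X] [CompleteSpace X]

/-- Since the common Gram operator `G` is invertible, `u = e' G⁻¹ e*` is an explicit choice, and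
every claim reduces to `G⁻¹ e* e = 1 = G⁻¹ e'* e'`. -/
lemma exists_partialIsometry {G : H →L[ℂ] H} (hG : IsUnit G) {e e' : H →L[ℂ] X}
    (he : adjoint e ∘L e = G) (he' : adjoint e' ∘L e' = G) :
    ∃ u : X →L[ℂ] X, u * star u * u = u ∧ (∀ h, u (e h) = e' h) ∧ ∀ h, star u (e' h) = e h := by
  set R := Ring.inverse G with hR
  have hRG : ∀ h, R (G h) = h := fun h =>
    congrArg (fun Z : H →L[ℂ] H => Z h) (Ring.inverse_mul_cancel G hG)
  have hGs : star G = G := by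
    rw [← he, star_eq_adjoint, adjoint_comp, adjoint_adjoint]
  have hRs : adjoint R = R := by
    rw [← star_eq_adjoint, hR, ← Ring.inverse_star, hGs]
  have h1 : ∀ h, R (adjoint e (e h)) = h := fun h => by
    have h0 : adjoint e (e h) = G h := congrArg (fun Z : H →L[ℂ] H => Z h) he
    rw [h0, hRG]
  have h2 : ∀ h, R (adjoint e' (e' h)) = h := fun h => by
    have h0 : adjoint e' (e' h) = G h := congrArg (fun Z : H →L[ℂ] H => Z h) he'
    rw [h0, hRG]
  have hu : star (e' ∘L R ∘L adjoint e) = e ∘L R ∘L adjoint e' := by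
    rw [star_eq_adjoint, adjoint_comp, adjoint_comp, adjoint_adjoint, hRs,
      ContinuousLinearMap.comp_assoc]
  refine ⟨e' ∘L R ∘L adjoint e, ?_, fun h => ?_, fun h => ?_⟩
  · ext x
    rw [hu]
    simp [h1, h2]
  · simp [h1]
  · rw [hu]
    simp [h2]

/-- Halmos' unitary dilation of a partial isometry. -/
def halmos (u : X →L[ℂ] X) : Matrix (Fin 2) (Fin 2) (X →L[ℂ] X) :=
  !![u, 1 - u * star u; 1 - star u * u, star u]

lemma star_halmos (u : X →L[ℂ] X) : star (halmos u) = halmos (star u) := by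
  ext1 i j
  fin_cases i <;> fin_cases j <;> simp [halmos, Matrix.star_apply]

/-- For a partial isometry `1 - uu*` and `1 - u*u` are already projections, so they serve as defect
operators without square roots. -/
lemma halmos_mul {u : X →L[ℂ] X} (hu : u * star u * u = u) :
    halmos u * halmos (star u) = 1 := by
  have hu' : star u * u * star u = star u := by
    simpa [mul_assoc] using congrArg star hu
  have h1 : u * (star u * u) = u := by rw [← mul_assoc, hu]
  have h2 : star u * (u * star u) = star u := by rw [← mul_assoc, hu']
  ext1 i j
  fin_cases i <;> fin_cases j <;>
    simp [halmos, Matrix.mul_apply, mul_sub, sub_mul, mul_assoc, h1, h2]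

lemma matrixOperator_halmos_mem_unitary {u : X →L[ℂ] X} (hu : u * star u * u = u) :
    matrixOperator (halmos u) ∈ unitary _ := by
  have hu' : star u * star (star u) * star u = star u := by
    simpa [mul_assoc] using congrArg star hu
  rw [Unitary.mem_iff, star_matrixOperator, star_halmos, ← matrixOperator_mul,
    ← matrixOperator_mul, halmos_mul hu]
  have := halmos_mul hu'
  rw [star_star] at this
  rw [this, matrixOperator_one]
  exact ⟨rfl, rfl⟩

/-- The second coordinate is `x - u*u x`, which vanishes on the initial space of `u`. -/
lemma matrixOperator_halmos_inclFst {u : X →L[ℂ] X} {x y : X} (h1 : u x = y) (h2 : star u y = x) :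
    matrixOperator (halmos u) (inclFst X x) = inclFst X y := by
  ext i
  rw [matrixOperator_apply, Fin.sum_univ_two, inclFst_zero, inclFst_one]
  fin_cases i
  · simp [halmos, h1, inclFst_zero]
  · simp [halmos, h1, h2, inclFst_one]

end UnitaryExtension

/-! ### Andô's construction when the product is a strict contraction. -/

section Ando

open ContinuousLinearMap

variable {H : Type*} [NormedAddCommGroup H] [InnerProductSpace ℂ H] [CompleteSpace H]

lemma exists_defect {A : H →L[ℂ] H} (hA : ‖A‖ ≤ 1) :
    ∃ d : H →L[ℂ] H, star d * d = 1 - star A * A := by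
  have h1 : ‖star A * A‖ ≤ 1 := by
    rw [CStarRing.norm_star_mul_self]
    exact mul_le_one₀ hA (norm_nonneg _) hA
  have h2 : star A * A ≤ 1 := (CStarAlgebra.norm_le_one_iff_of_nonneg _ (star_mul_self_nonneg A)).1 h1
  obtain ⟨d, hd⟩ := CStarAlgebra.nonneg_iff_eq_star_mul_self.1 (sub_nonneg.2 h2)
  exact ⟨d, hd.symm⟩

lemma adjoint_pairMap_comp (f g : H →L[ℂ] H) :
    adjoint (pairMap f g) ∘L pairMap f g = star f * f + star g * g := by
  refine ContinuousLinearMap.ext fun x => ext_inner_right ℂ fun y => ?_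
  simp only [ContinuousLinearMap.comp_apply, adjoint_inner_left, PiLp.inner_apply,
    Fin.sum_univ_two, pairMap_zero, pairMap_one, add_apply, mul_apply_eq_comp, inner_add_left,
    star_eq_adjoint]

lemma norm_sq_of_adjoint_comp {X : Type*} [NormedAddCommGroup X] [InnerProductSpace ℂ X]
    [CompleteSpace X] {e : H →L[ℂ] X} {T : H →L[ℂ] H} (he : adjoint e ∘L e = 1 - star T * T)
    (h : H) : ‖e h‖ ^ 2 = ‖h‖ ^ 2 - ‖T h‖ ^ 2 := by
  have h1 : inner ℂ (e h) (e h) = inner ℂ h h - inner ℂ (T h) (T h) := by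
    rw [← adjoint_inner_left, ← ContinuousLinearMap.comp_apply, he, ← adjoint_inner_left T,
      ← inner_sub_left]
    rfl
  simp only [inner_self_eq_norm_sq_to_K] at h1
  exact_mod_cast h1

variable {ι : Type*} [Fintype ι] [DecidableEq ι]

/-- Von Neumann's inequality for two commuting contractions with a strictly contractive
product. -/
theorem norm_matrixOperator_ratEval_le_of_norm_mul_lt {A B : H →L[ℂ] H} (hA : ‖A‖ ≤ 1)
    (hB : ‖B‖ ≤ 1) (hAB : Commute A B) (hT : ‖A * B‖ < 1)
    (a b : Matrix ι ι (MvPolynomial (Fin 3) ℂ))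
    (hb : ∀ i j, ∀ z ∈ bidiscGraph, (b i j).eval z ≠ 0) {M : ℝ} (hM0 : 0 ≤ M)
    (hM : ∀ z ∈ bidiscGraph, ‖Matrix.toEuclideanCLM (n := ι) (𝕜 := ℂ)
      (Matrix.of fun i j => (a i j).eval z / (b i j).eval z)‖ ≤ M) :
    ‖matrixOperator (Matrix.of fun i j => ratEval (graphTriple A B) (a i j) (b i j))‖ ≤ M := by
  obtain ⟨dA, hdA⟩ := exists_defect hA
  obtain ⟨dB, hdB⟩ := exists_defect hB
  -- The two ways of telescoping `1 - T*T` for `T = AB = BA`: through `A*A` for `e` and through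
  -- `B*B` for `e'`.
  set e := pairMap dA (dB * A) with he_def
  set e' := pairMap (dA * B) dB with he'_def
  have he : adjoint e ∘L e = 1 - star (A * B) * (A * B) := by
    rw [he_def, adjoint_pairMap_comp, star_mul, mul_assoc, ← mul_assoc (star dB), hdA, hdB,
      hAB.eq, star_mul]
    noncomm_ring
  have he' : adjoint e' ∘L e' = 1 - star (A * B) * (A * B) := by
    rw [he'_def, adjoint_pairMap_comp, star_mul, mul_assoc, ← mul_assoc (star dA), hdA, hdB,
      star_mul]
    noncomm_ring
  have hG : IsUnit (1 - star (A * B) * (A * B)) := by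
    refine (Units.oneSub (star (A * B) * (A * B)) ?_).isUnit
    rw [CStarRing.norm_star_mul_self]
    nlinarith [norm_nonneg (A * B)]
  obtain ⟨u, hu, hue, hue'⟩ := exists_partialIsometry hG he he'
  set p₀ : PiLp 2 (fun _ : Fin 2 => H) →L[ℂ] PiLp 2 (fun _ : Fin 2 => H) :=
    matrixOperator !![1, 0; 0, 0] with hp₀
  have hp₀s : star p₀ = p₀ := by
    rw [hp₀, star_matrixOperator]
    congr 1
    ext1 i j
    fin_cases i <;> fin_cases j <;> simp [Matrix.star_apply]
  have hp₀i : p₀ * p₀ = p₀ := by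
    rw [hp₀, ← matrixOperator_mul]
    congr 1
    ext1 i j
    fin_cases i <;> fin_cases j <;> simp [Matrix.mul_apply]
  have hp₀0 : ∀ x, p₀ x 0 = x 0 := fun x => by
    rw [hp₀, matrixOperator_apply, Fin.sum_univ_two]; simp
  have hp₀1 : ∀ x, p₀ x 1 = 0 := fun x => by
    rw [hp₀, matrixOperator_apply, Fin.sum_univ_two]; simp
  -- On the copy of `H ⊕ H` added by the Halmos extension `p` is zero; what matters is that it
  -- restricts to `p₀` on the original copy.
  set p := matrixOperator !![p₀, 0; 0, 0] with hp
  have hps : IsStarProjection p := by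
    refine ⟨?_, ?_⟩
    · rw [IsIdempotentElem, hp, ← matrixOperator_mul]
      congr 1
      ext1 i j
      fin_cases i <;> fin_cases j <;> simp [Matrix.mul_apply, hp₀i]
    · rw [IsSelfAdjoint, hp, star_matrixOperator]
      congr 1
      ext1 i j
      fin_cases i <;> fin_cases j <;> simp [Matrix.star_apply, hp₀s]
  have hpincl : ∀ x, p (inclFst _ x) = inclFst _ (p₀ x) := fun x => by
    ext1 i
    rw [hp, matrixOperator_apply, Fin.sum_univ_two, inclFst_zero, inclFst_one]
    fin_cases i
    · simp [inclFst_zero]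
    · simp [inclFst_one]
  have hcomb : ∀ x y z, p₀ x + (y - p₀ y) = z →
      p (inclFst _ x) + (1 - p) (inclFst _ y) = inclFst _ z := by
    rintro x y z rfl
    rw [sub_apply, one_apply_eq_self, hpincl, hpincl, map_add, map_sub]
  have hW : ∀ h, matrixOperator (halmos u) (inclFst _ (e h)) = inclFst _ (e' h) := fun h =>
    matrixOperator_halmos_inclFst (hue h) (hue' h)
  have hBA : ∀ h, A (B h) = B (A h) := fun h => congrArg (fun Z : H →L[ℂ] H => Z h) hAB.eq
  refine norm_matrixOperator_ratEval_le_of_model hA hB hAB hT (e := inclFst _ ∘L e) (p := p)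
    (W := matrixOperator (halmos u))
    (fun h => ?_) (matrixOperator_halmos_mem_unitary hu) hps (fun h => ?_) (fun h => ?_)
    a b hb hM0 hM
  · rw [ContinuousLinearMap.comp_apply, norm_inclFst, norm_sq_of_adjoint_comp he]
  · simp only [ContinuousLinearMap.comp_apply, hW]
    -- Both sides are the image of `(d_A B A h, d_B A h)`: the first coordinate is that of `e (T
    -- h)`, the second that of `e h`.
    refine (hcomb _ _ _ ?_).symm
    ext i
    fin_cases i
    · simp [hp₀0, e, e', pairMap_zero, hBA]
    · simp [hp₀1, e, e', pairMap_one]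
  · simp only [ContinuousLinearMap.comp_apply, hW]
    -- Here the first coordinate of `e' h` and the second of `e' (T h)` combine to `(d_A B h, d_B A
    -- B h) = e (B h)`.
    refine hcomb _ _ _ ?_
    ext i
    fin_cases i
    · simp [hp₀0, e, e', pairMap_zero]
    · simp [hp₀1, e, e', pairMap_one, hBA]

end Ando

/-! ### Removal of strictness by scaling. -/

section Ando

open Filter Topology

variable {H : Type*} [NormedAddCommGroup H] [InnerProductSpace ℂ H] [CompleteSpace H]
  {ι : Type*} [Fintype ι] [DecidableEq ι]

lemma continuous_polyEval_graphTriple (P Q : H →L[ℂ] H) (p : MvPolynomial (Fin 3) ℂ) :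
    Continuous fun r : ℝ => polyEval (graphTriple ((r : ℂ) • P) ((r : ℂ) • Q)) p := by
  have h : ∀ T : Fin 3 → H →L[ℂ] H, polyEval T p = ∑ m ∈ p.support,
      p.coeff m • (T 0 ^ m 0 * (T 1 ^ m 1 * T 2 ^ m 2)) := fun T => by
    refine Finset.sum_congr rfl fun m _ => ?_
    simp [List.ofFn_succ]
  simp only [h, graphTriple, Matrix.cons_val_zero, Matrix.cons_val_one, Matrix.cons_val]
  fun_prop

lemma continuousAt_ratEval_graphTriple {P Q : H →L[ℂ] H} (p : MvPolynomial (Fin 3) ℂ)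
    {q : MvPolynomial (Fin 3) ℂ} (hq : IsUnit (polyEval (graphTriple P Q) q)) :
    ContinuousAt (fun r : ℝ => ratEval (graphTriple ((r : ℂ) • P) ((r : ℂ) • Q)) p q) 1 := by
  refine (continuous_polyEval_graphTriple P Q p).continuousAt.mul ?_
  have h1 : graphTriple (((1 : ℝ) : ℂ) • P) (((1 : ℝ) : ℂ) • Q) = graphTriple P Q := by simp
  obtain ⟨u, hu⟩ := hq
  have h2 := NormedRing.inverse_continuousAt u
  rw [hu, ← h1] at h2
  exact ContinuousAt.comp (g := Ring.inverse)
    (f := fun r : ℝ => polyEval (graphTriple ((r : ℂ) • P) ((r : ℂ) • Q)) q) h2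
    (continuous_polyEval_graphTriple P Q q).continuousAt

/-- **Andô's inequality**: von Neumann's inequality for matrices of rational functions of two
commuting contractions. -/
theorem norm_matrixOperator_ratEval_le {P Q : H →L[ℂ] H} (hP : ‖P‖ ≤ 1)
    (hQ : ‖Q‖ ≤ 1) (hPQ : Commute P Q) (a b : Matrix ι ι (MvPolynomial (Fin 3) ℂ))
    (hb : ∀ i j, ∀ z ∈ bidiscGraph, (b i j).eval z ≠ 0) {M : ℝ} (hM0 : 0 ≤ M)
    (hM : ∀ z ∈ bidiscGraph, ‖Matrix.toEuclideanCLM (n := ι) (𝕜 := ℂ)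
      (Matrix.of fun i j => (a i j).eval z / (b i j).eval z)‖ ≤ M) :
    ‖matrixOperator (Matrix.of fun i j => ratEval (graphTriple P Q) (a i j) (b i j))‖ ≤ M := by
  set F : ℝ → Matrix ι ι (H →L[ℂ] H) := fun r => Matrix.of fun i j =>
    ratEval (graphTriple ((r : ℂ) • P) ((r : ℂ) • Q)) (a i j) (b i j) with hF
  have hF1 : (Matrix.of fun i j => ratEval (graphTriple P Q) (a i j) (b i j)) = F 1 := by
    simp [hF]
  have hcont : ∀ i j, ContinuousAt (fun r => F r i j) 1 := fun i j =>
    continuousAt_ratEval_graphTriple (a i j) (isUnit_polyEval_graphTriple hP hQ hPQ (hb i j))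
  have hlt : ∀ r ∈ Set.Ioo (0 : ℝ) 1, ‖matrixOperator (F r)‖ ≤ M := fun r hr => by
    have hsm : ∀ X : H →L[ℂ] H, ‖X‖ ≤ 1 → ‖(r : ℂ) • X‖ ≤ r := fun X hX => by
      rw [norm_smul, Complex.norm_real, Real.norm_of_nonneg hr.1.le]
      exact mul_le_of_le_one_right hr.1.le hX
    refine norm_matrixOperator_ratEval_le_of_norm_mul_lt ((hsm P hP).trans hr.2.le)
      ((hsm Q hQ).trans hr.2.le) ((hPQ.smul_left _).smul_right _) ?_ a b hb hM0 hM
    refine (norm_mul_le _ _).trans_lt ?_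
    refine (mul_le_mul (hsm P hP) (hsm Q hQ) (norm_nonneg _) hr.1.le).trans_lt ?_
    nlinarith [hr.1, hr.2]
  rw [hF1]
  -- The limit `r → 1` is taken vector by vector, so continuity of the entries at `r = 1` is enough.
  refine ContinuousLinearMap.opNorm_le_bound _ hM0 fun x => ?_
  have hx : ContinuousAt (fun r => ‖matrixOperator (F r) x‖) 1 := by
    simp only [PiLp.norm_eq_of_L2, matrixOperator_apply]
    fun_prop
  refine le_of_tendsto (hx.tendsto.mono_left (nhdsWithin_le_nhds (s := Set.Iio 1))) ?_
  filter_upwards [Ioo_mem_nhdsLT (zero_lt_one (α := ℝ))] with r hr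
  exact ContinuousLinearMap.le_of_opNorm_le _ (hlt r hr) x

end Ando

end Tetrablock

end

theorem proposition3 {H : Type*} [NormedAddCommGroup H] [InnerProductSpace ℂ H] [CompleteSpace H]
    (T : Fin 3 → H →L[ℂ] H) (hT : Tetrablock.IsTriangularEContraction T) :
    Tetrablock.IsCompleteSpectralSet (closure Tetrablock.triangularVariety) T := by
  obtain ⟨-, P, Q, hP, hQ, hPQ, rfl⟩ := hT
  have hsub := Tetrablock.bidiscGraph_subset_closure
  refine ⟨(Tetrablock.taylorSpectrum_subset_bidiscGraph hP hQ hPQ).trans hsub,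
    fun k p q hq => ?_⟩
  have hq' : ∀ i j, ∀ z ∈ Tetrablock.bidiscGraph, (q i j).eval z ≠ 0 :=
    fun i j z hz => hq i j z (hsub hz)
  refine ⟨fun i j => Tetrablock.isUnit_polyEval_graphTriple hP hQ hPQ (hq' i j), ?_⟩
  set S := ⨆ z ∈ closure Tetrablock.triangularVariety,
    ‖Matrix.toEuclideanCLM (n := Fin k) (𝕜 := ℂ)
      (Matrix.of fun i j => (p i j).eval z / (q i j).eval z)‖ₑ with hS
  -- The supremum lives in `[0, ∞]`; when it is finite, its real value serves as the bound `M`.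
  rcases eq_or_ne S ⊤ with htop | htop
  · rw [htop]
    exact le_top
  rw [← ENNReal.ofReal_toReal htop, ← ofReal_norm]
  refine ENNReal.ofReal_le_ofReal ?_
  refine Tetrablock.norm_matrixOperator_ratEval_le hP hQ hPQ p q hq' ENNReal.toReal_nonneg
    fun z hz => ?_
  rw [← toReal_enorm]
  refine ENNReal.toReal_mono htop ?_
  exact le_iSup₂ (f := fun z (_ : z ∈ closure Tetrablock.triangularVariety) =>
    ‖Matrix.toEuclideanCLM (n := Fin k) (𝕜 := ℂ)
      (Matrix.of fun i j => (p i j).eval z / (q i j).eval z)‖ₑ) z (hsub hz)
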